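/- **Proposition 3.1 (First Growth Lemma).** Let $n\ge 1$. Write $B_\rho(x)$ for the open Euclidean ball in $\mathbb{R}^n$, and $(f)_B=\frac1{|B|}\int_B f\,dx$. A weight $\omega:\mathbb{R}^n\to[0,\infty)$, locally integrable and positive almost everywhere, belongs to $A_{1+\frac1n}$ if $$[\omega]_{A_{1+\frac1n}}=\sup_{B}\,(\omega)_{B}\,\big((\omega^{-n})_{B}\big)^{1/n}<\infty ,$$ the supremum being over all balls $B\subset\mathbb{R}^n$. For such $\omega$ put $\mu=\omega^{-n}$, $\omega(B)=\int_B\omega\,dx$, $\mu(E)=\int_E\mu(x)\,dx\,dt$ for measurable $E\subset\mathbb{R}^{n+1}$, and, for $r>0$, $Y=(y,s)\in\mathbb{R}^n\times\mathbb{R}$, $$C_{r,\mu}(Y)=B_r(y)\times\big(s-r^2(\mu)_{B_r(y)}^{1/n},\,s\big).$$ For an open set $U\subset\mathbb{R}^n$ put $$[[\omega]]_{\mathrm{BMO}(U,\omega)}=\sup_{B\subset U}\Big(\frac1{\omega(B)}\int_B|\omega-(\omega)_B|^{n+1}\,\omega^{-n}\,dx\Big)^{\frac1{n+1}},$$ the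 supremum being over all balls $B\subset U$. Let $\mathcal{L}u=u_t-\omega(x)\,a_{ij}(x,t)\,D_{ij}u$ (summation over $i,j$). For every $K_0\in[1,\infty)$ and $\nu\in(0,1)$ there exists a constant $N=N(n,\nu,K_0)>0$ such that the following holds. Let $r>0$, $Y=(y,s)\in\mathbb{R}^{n+1}$, and let $\omega\in A_{1+\frac1n}$ satisfy $$[\omega]_{A_{1+\frac1n}}\le K_0\quad\text{and}\quad[[\omega]]_{\mathrm{BMO}(B_r(y),\omega)}\le\epsilon_0\quad\text{for some }\epsilon_0\in(0,1).$$ Let the matrix $(a_{ij})$ be measurable and symmetric with $$\nu|\xi|^2\le a_{ij}(x,t)\xi_i\xi_j,\qquad |a_{ij}(x,t)|\le\nu^{-1}\qquad\text{for all }\xi\in\mathbb{R}^n,\ 1\le i,j\le n,\ (x,t)\in C_{r,\mu}(Y).$$ Then, for every $u\in C^{2,1}(C_{r,\mu}(Y))\cap C(\overline{C_{r,\mu}(Y)})$ satisfying $\mathcal{L}u\le0$ in $C_{r,\mu}(Y)$ and $$\mu\big(C_{r,\mu}(Y)\cap\{u>0\}\big)\le\delta_0\,\mu\big(C_{r,\mu}(Y)\big)\quad\text{for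 some }\delta_0\in(0,1),$$ it holds that $$\sup_{C_{r/2,\mu}(Y)}u^+\le\min\Big\{N\big(\delta_0^{\frac1{n+1}}+\epsilon_0\big),\,1\Big\}\,\sup_{C_{r,\mu}(Y)}u^+ .$$ Here $u\in C^{2,1}(\Omega)$ means that $u$ and its classical derivatives $u_t$, $D_iu$, $D_{ij}u$ exist and are continuous in $\Omega$, and $u^+=\max\{u,0\}$. -/

import Mathlib

open MeasureTheory Set Metric
open scoped ENNReal

noncomputable section

/-- Points `X = (x, t)` of `ℝⁿ × ℝ = ℝⁿ⁺¹`, where `ℝⁿ` carries the Euclidean norm.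
The measure `volume` on it is Lebesgue measure. -/
abbrev SpaceTime (n : ℕ) : Type := EuclideanSpace ℝ (Fin n) × ℝ

section Weights

variable {n : ℕ}

/-- The Muckenhoupt constant `[σ]_{A_p}`, for `1 < p < ∞`: the supremum over all balls `B` of
`(σ)_B * ((σ^{-1/(p-1)})_B)^{p-1}`, as an extended nonnegative number (so that
`0^{-1/(p-1)} = ∞` and no integrability is presupposed). -/
def muckenhouptConst (p : ℝ) (σ : EuclideanSpace ℝ (Fin n) → ℝ) : ℝ≥0∞ :=
  ⨆ (x₀ : EuclideanSpace ℝ (Fin n)) (ρ : ℝ) (_ : 0 < ρ),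
    (⨍⁻ x in ball x₀ ρ, ENNReal.ofReal (σ x) ∂volume) *
      (⨍⁻ x in ball x₀ ρ, ENNReal.ofReal (σ x) ^ (-1 / (p - 1)) ∂volume) ^ (p - 1)

/-- The class `A_p`, for `1 < p < ∞`: nonnegative, locally integrable weights, positive almost
everywhere, with finite Muckenhoupt constant. (Almost everywhere positivity only excludes the
weight that vanishes almost everywhere, for which the product above would be `0 * ∞`.) -/
structure IsMuckenhoupt (p : ℝ) (σ : EuclideanSpace ℝ (Fin n) → ℝ) : Prop where
  nonneg : ∀ x, 0 ≤ σ x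
  locallyIntegrable : LocallyIntegrable σ
  pos_ae : ∀ᵐ x, 0 < σ x
  const_lt_top : muckenhouptConst p σ < ∞

/-- The dual weight `μ(x) = ω(x)^{-n}`, with value `∞` where `ω` vanishes. -/
def dualWeight (ω : EuclideanSpace ℝ (Fin n) → ℝ) (x : EuclideanSpace ℝ (Fin n)) : ℝ≥0∞ :=
  ENNReal.ofReal (ω x) ^ (-(n : ℝ))

/-- The mean oscillation `[[f]]_{B_ρ(x₀), ω}` of `f` on a ball with respect to the weight `ω`:
`( ω(B)⁻¹ ∫_B |f - (f)_B|^{n+1} ω^{-n} dx )^{1/(n+1)}`. -/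
def weightedOsc (ω f : EuclideanSpace ℝ (Fin n) → ℝ)
    (x₀ : EuclideanSpace ℝ (Fin n)) (ρ : ℝ) : ℝ≥0∞ :=
  ((∫⁻ x in ball x₀ ρ, ENNReal.ofReal (ω x))⁻¹ *
      ∫⁻ x in ball x₀ ρ,
        ENNReal.ofReal |f x - ⨍ z in ball x₀ ρ, f z| ^ (n + 1) * dualWeight ω x) ^
    (1 / ((n : ℝ) + 1))

/-- The weighted seminorm `[[f]]_{BMO(Ω, ω)}`: the supremum of the weighted mean oscillation
over all balls contained in `Ω`. -/
def weightedBMO (ω f : EuclideanSpace ℝ (Fin n) → ℝ)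
    (Ω : Set (EuclideanSpace ℝ (Fin n))) : ℝ≥0∞ :=
  ⨆ (x₀ : EuclideanSpace ℝ (Fin n)) (ρ : ℝ) (_ : 0 < ρ) (_ : ball x₀ ρ ⊆ Ω),
    weightedOsc ω f x₀ ρ

/-- The weighted parabolic cylinder
`C_{r,μ}(y, s) = B_r(y) × (s - r² ((μ)_{B_r(y)})^{1/n}, s)`, where `μ = ω^{-n}`.
(For `ω` in `A_{1+1/n}` the mean of `μ` over a ball is finite and positive.) -/
def weightedCylinder (ω : EuclideanSpace ℝ (Fin n) → ℝ) (r : ℝ) (Y : SpaceTime n) :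
    Set (SpaceTime n) :=
  ball Y.1 r ×ˢ
    Ioo (Y.2 - r ^ 2 * (⨍⁻ x in ball Y.1 r, dualWeight ω x ∂volume).toReal ^ (1 / (n : ℝ))) Y.2

/-- `μ(E) = ∫_E μ(x) dx dt` for sets `E` in space-time, where `μ = ω^{-n}`. -/
def dualMass (ω : EuclideanSpace ℝ (Fin n) → ℝ) (E : Set (SpaceTime n)) : ℝ≥0∞ :=
  ∫⁻ X in E, dualWeight ω X.1

end Weights

section Operator

variable {n : ℕ}

/-- The time derivative `u_t`. -/
def timeDeriv (u : SpaceTime n → ℝ) (X : SpaceTime n) : ℝ :=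
  deriv (fun t => u (X.1, t)) X.2

/-- The spatial partial derivative `D_i u`. -/
def spaceDeriv (i : Fin n) (u : SpaceTime n → ℝ) (X : SpaceTime n) : ℝ :=
  lineDeriv ℝ (fun x => u (x, X.2)) X.1 (EuclideanSpace.single i 1)

/-- The second order spatial partial derivative `D_{ij} u = D_i (D_j u)`. -/
def spaceDeriv₂ (i j : Fin n) (u : SpaceTime n → ℝ) : SpaceTime n → ℝ :=
  spaceDeriv i (spaceDeriv j u)

/-- `u ∈ C^{2,1}(Ω)` for an open set `Ω`: the classical derivatives `u_t`, `D_i u`, `D_{ij} u`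
exist at every point of `Ω`, and they and `u` are continuous in `Ω`. -/
structure IsC21On (u : SpaceTime n → ℝ) (Ω : Set (SpaceTime n)) : Prop where
  continuousOn : ContinuousOn u Ω
  time_differentiable : ∀ X ∈ Ω, DifferentiableAt ℝ (fun t => u (X.1, t)) X.2
  time_continuousOn : ContinuousOn (timeDeriv u) Ω
  space_differentiable : ∀ i, ∀ X ∈ Ω,
    LineDifferentiableAt ℝ (fun x => u (x, X.2)) X.1 (EuclideanSpace.single i 1)
  space_continuousOn : ∀ i, ContinuousOn (spaceDeriv i u) Ω
  space₂_differentiable : ∀ i j, ∀ X ∈ Ω,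
    LineDifferentiableAt ℝ (fun x => spaceDeriv j u (x, X.2)) X.1 (EuclideanSpace.single i 1)
  space₂_continuousOn : ∀ i j, ContinuousOn (spaceDeriv₂ i j u) Ω

/-- The coefficient matrix `(a_{ij})` is (Lebesgue) measurable and symmetric in `Ω` and satisfies
`ν |ξ|² ≤ a_{ij} ξ_i ξ_j` and `|a_{ij}| ≤ ν⁻¹` at every point of `Ω`. -/
structure IsElliptic (ν : ℝ) (a : SpaceTime n → Matrix (Fin n) (Fin n) ℝ)
    (Ω : Set (SpaceTime n)) : Prop where
  aemeasurable : ∀ i j, AEMeasurable (fun X => a X i j) (volume.restrict Ω)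
  symm : ∀ X ∈ Ω, (a X).IsSymm
  lower : ∀ X ∈ Ω, ∀ ξ : EuclideanSpace ℝ (Fin n),
    ν * ‖ξ‖ ^ 2 ≤ ∑ i, ∑ j, a X i j * ξ i * ξ j
  upper : ∀ X ∈ Ω, ∀ i j, |a X i j| ≤ ν⁻¹

/-- The operator `𝓛 u = u_t - ω(x) a_{ij}(x, t) D_{ij} u`. -/
def parabolicOp (ω : EuclideanSpace ℝ (Fin n) → ℝ)
    (a : SpaceTime n → Matrix (Fin n) (Fin n) ℝ) (u : SpaceTime n → ℝ) (X : SpaceTime n) : ℝ :=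
  timeDeriv u X - ω X.1 * ∑ i, ∑ j, a X i j * spaceDeriv₂ i j u X

/-- `sup_S u⁺`, where `u⁺ = max u 0`, for a function `u` that is bounded above on a nonempty
set `S`. -/
def supPos (u : SpaceTime n → ℝ) (S : Set (SpaceTime n)) : ℝ :=
  sSup ((fun X => max (u X) 0) '' S)

end Operator

end

/-! Fix a point (x₀, t₀) of the half cylinder with m = u(x₀, t₀) > 0, and put M = sup u⁺ over the
full cylinder, α = (ω)_B and β = ((ω⁻ⁿ)_B)^{1/n}. Subtract from u a barrier, quadratic in x and
linear in t, that vanishes at (x₀, t₀) and is at least M on the bottom and on the lateral boundary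
up to time t₀. The difference v is nonpositive there and equals m at (x₀, t₀). The
Aleksandrov–Bakelman–Pucci–Krylov–Tso argument (`parabolic_abp`) bounds m^{n+1} / rⁿ, up to a
constant, by the integral of (v_t + η)|det D²v| over a set Q ⊆ {v > 0} ⊆ {u > 0} where v_t + η ≥ 0
and D²v ≤ 0.

On Q the inequality 𝓛u ≤ 0 bounds both v_t + η and ω tr(-D²v) by a multiple of (M/r²)(|ω - α| + α),
so the integrand is at most a multiple of (M/r²)^{n+1} (|ω - α| + α)^{n+1} ω⁻ⁿ
(`Matrix.PosSemidef.mul_det_le`, `exists_contactSet_of_subsolution`). The oscillation part,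
integrated over the whole cylinder, is controlled by the BMO seminorm and yields ε₀^{n+1}. The
constant part is α^{n+1} μ(Q), and Q ⊆ {u > 0} yields δ₀. Since 1 ≤ αβ ≤ K₀, all weights cancel
(`lintegral_contactSet_bound`), and an (n+1)-st root finishes the proof.

For u of class C^{2,1} the gradient need not be differentiable in time, so the change of variables
in space-time is replaced by a spatial area inequality on each time slice, applied to finite time
differences of a Legendre-type transform and then telescoped. -/

noncomputable section

/-! ### Weighted area inequality -/

section Area

variable {E : Type*} [NormedAddCommGroup E] [NormedSpace ℝ E] [FiniteDimensional ℝ E]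
  [MeasurableSpace E] [BorelSpace E]

/-- Weighted area inequality: if `G ≤ w x` for some preimage `x ∈ S` of `ξ` whenever `G ξ > 0`,
then `∫ G ≤ ∫_S w |det Φ'|`. -/
theorem lintegral_le_lintegral_mul_abs_det (μ : Measure E) [μ.IsAddHaarMeasure] {S T : Set E}
    (hS : IsClosed S) {Φ : E → E} {Φ' : E → E →L[ℝ] E}
    (hΦ : ∀ x ∈ S, HasFDerivWithinAt Φ (Φ' x) S x) {G w : E → ℝ} (hG : Measurable G)
    (hG0 : ∀ ξ, 0 ≤ G ξ) (hw : ContinuousOn w S) (hw0 : ∀ x ∈ S, 0 ≤ w x)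
    (h : ∀ ξ ∈ T, 0 < G ξ → ∃ x ∈ S, Φ x = ξ ∧ G ξ ≤ w x) :
    ∫⁻ ξ in T, ENNReal.ofReal (G ξ) ∂μ ≤
      ∫⁻ x in S, ENNReal.ofReal |(Φ' x).det| * ENNReal.ofReal (w x) ∂μ := by
  have hSm := hS.measurableSet
  have hdet := aemeasurable_ofReal_abs_det_fderivWithin μ hSm hΦ
  have hwm : AEMeasurable w (μ.restrict S) := hw.aemeasurable hSm
  set ν := (μ.restrict S).withDensity fun x => ENNReal.ofReal |(Φ' x).det| with hν
  have hac : ν ≪ μ.restrict S := withDensity_absolutelyContinuous _ _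
  have e1 : ∫⁻ x in S, ENNReal.ofReal |(Φ' x).det| * ENNReal.ofReal (w x) ∂μ =
      ∫⁻ x, ENNReal.ofReal (w x) ∂ν :=
    (lintegral_withDensity_eq_lintegral_mul₀ hdet hwm.ennreal_ofReal).symm
  -- Layer cake on both sides: it suffices that, at each level y, {G > y} lies in the image of {w >
  -- y}, to which the unweighted area inequality applies.
  rw [e1, lintegral_eq_lintegral_meas_lt _ (Filter.Eventually.of_forall hG0) hG.aemeasurable,
    lintegral_eq_lintegral_meas_lt ν (hac.ae_le (ae_restrict_of_forall_mem hSm hw0))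
      (hwm.mono_ac hac)]
  refine setLIntegral_mono' measurableSet_Ioi fun y hy => ?_
  have hA : MeasurableSet (S ∩ {x | y < w x}) := by
    have : S ∩ {x | y < w x} = S \ (S ∩ w ⁻¹' Iic y) := by ext; simp +contextual
    rw [this]
    exact hSm.diff (hw.preimage_isClosed_of_isClosed hS isClosed_Iic).measurableSet
  calc μ.restrict T {ξ | y < G ξ}
      ≤ μ (Φ '' (S ∩ {x | y < w x})) := by
        rw [Measure.restrict_apply (measurableSet_lt measurable_const hG)]
        refine measure_mono fun ξ hξ => ?_
        obtain ⟨x, hx, hxξ, hle⟩ := h ξ hξ.2 (lt_trans hy hξ.1)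
        exact ⟨x, ⟨hx, lt_of_lt_of_le hξ.1 hle⟩, hxξ⟩
    _ ≤ ∫⁻ x in S ∩ {x | y < w x}, ENNReal.ofReal |(Φ' x).det| ∂μ :=
        addHaar_image_le_lintegral_abs_det_fderiv μ hA
          fun x hx => (hΦ x hx.1).mono inter_subset_left
    _ = ν (S ∩ {x | y < w x}) := by
        rw [hν, withDensity_apply _ hA, Measure.restrict_restrict hA]
        congr 2; ext; simp +contextual
    _ ≤ ν {x | y < w x} := measure_mono inter_subset_right

end Area

/-! ### Necessary conditions at a maximum -/

section Hessian

variable {E : Type*} [NormedAddCommGroup E] [InnerProductSpace ℝ E]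

/-- First and second order necessary conditions at a local maximum of `f - ⟪ξ, ·⟫`. -/
theorem IsLocalMax.gradient_eq_and_hessian_nonpos {f : E → ℝ} {g : E → E} {H : E →L[ℝ] E}
    {x ξ : E} (hf : ∀ᶠ z in nhds x, HasFDerivAt f (innerSL ℝ (g z)) z)
    (hg : HasFDerivAt g H x) (hmax : IsLocalMax (fun z => f z - inner ℝ ξ z) x) :
    g x = ξ ∧ ∀ z, inner ℝ (H z) z ≤ 0 := by
  have hξ : ∀ z, HasFDerivAt (fun z => inner ℝ ξ z) (innerSL ℝ ξ) z := fun z =>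
    (innerSL ℝ ξ).hasFDerivAt
  have hgx : g x = ξ := by
    have := hmax.hasFDerivAt_eq_zero (hf.self_of_nhds.sub (hξ x))
    rw [sub_eq_zero] at this
    refine ext_inner_right ℝ fun z => ?_
    simpa using DFunLike.congr_fun this z
  refine ⟨hgx, fun z => ?_⟩
  by_contra! hpos
  set φ : ℝ → ℝ := fun s => f (x + s • z) - inner ℝ ξ (x + s • z) with hφ
  have hline : ∀ s : ℝ, HasDerivAt (fun s : ℝ => x + s • z) z s := fun s => by
    simpa using ((hasDerivAt_id s).smul_const z).const_add x
  have hcont : ContinuousAt (fun s : ℝ => x + s • z) 0 := (hline 0).continuousAt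
  have htend : Filter.Tendsto (fun s : ℝ => x + s • z) (nhds 0) (nhds x) := by
    simpa [ContinuousAt] using hcont
  have h1 : ∀ᶠ s in nhds (0 : ℝ), HasDerivAt φ (inner ℝ (g (x + s • z)) z - inner ℝ ξ z) s := by
    filter_upwards [htend.eventually hf] with s hs
    exact (hs.sub (hξ _)).comp_hasDerivAt s (hline s)
  have hd : deriv φ =ᶠ[nhds 0] fun s => inner ℝ (g (x + s • z)) z - inner ℝ ξ z := by
    filter_upwards [h1] with s hs using hs.deriv
  have h2 : HasDerivAt (deriv φ) (inner ℝ (H z) z) 0 := by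
    refine HasDerivAt.congr_of_eventuallyEq ?_ hd
    have hg' : HasDerivAt (fun s : ℝ => g (x + s • z)) (H z) 0 :=
      HasFDerivAt.comp_hasDerivAt (0 : ℝ) (by simpa using hg) (hline 0)
    simpa using (hg'.inner ℝ (hasDerivAt_const (0 : ℝ) z)).sub_const (inner ℝ ξ z)
  have hmaxφ : IsLocalMax φ 0 := by
    have := htend.eventually hmax
    simpa [IsLocalMax, IsMaxFilter, φ] using this
  -- A positive second derivative along the line would make 0 a local minimum as well as a local
  -- maximum, so φ would be locally constant, with vanishing second derivative.
  have hminφ : IsLocalMin φ 0 := by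
    refine isLocalMin_of_deriv_deriv_pos (by rw [h2.deriv]; exact hpos) ?_
      h1.self_of_nhds.continuousAt
    rw [h1.self_of_nhds.deriv]; simp [hgx]
  have hconst : φ =ᶠ[nhds 0] fun _ => φ 0 := by
    filter_upwards [hmaxφ, hminφ] with s hs1 hs2 using le_antisymm hs1 hs2
  have : deriv φ =ᶠ[nhds 0] deriv fun _ => φ 0 := hconst.deriv
  have h3 := this.deriv_eq
  rw [h2.deriv] at h3
  simp at h3
  exact hpos.ne' h3

end Hessian

/-! ### Uniform difference quotients in time -/

section ContactSet

variable {E : Type*} [NormedAddCommGroup E] [InnerProductSpace ℝ E] [FiniteDimensional ℝ E]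

/-- Backward difference quotients in time are controlled by the time derivative, uniformly on
a compact superlevel set. -/
theorem exists_forall_sub_le_mul_timeDeriv {v vt : E × ℝ → ℝ} {Ω K : Set (E × ℝ)}
    (hvt : ∀ X ∈ Ω, HasDerivAt (fun t => v (X.1, t)) (vt X) X.2)
    (hvtc : ContinuousOn vt Ω) (hK : IsCompact K) (hΩ : IsOpen Ω) (hKΩ : K ⊆ Ω)
    {η : ℝ} (hη : 0 < η) :
    ∃ d > 0, ∀ τ, 0 < τ → τ ≤ d → ∀ X ∈ K,
      v X - v (X.1, X.2 - τ) ≤ τ * (vt X + η) := by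
  -- A compact thickening inside Ω contains the backward time segments from K; there `vt` is
  -- uniformly continuous and the mean value theorem applies.
  obtain ⟨δ, hδ, hδΩ⟩ := hK.exists_cthickening_subset_open hΩ hKΩ
  have hK' : IsCompact (cthickening δ K) := hK.cthickening
  have huc := hK'.uniformContinuousOn_of_continuous (hvtc.mono hδΩ)
  obtain ⟨e, he, hve⟩ := Metric.uniformContinuousOn_iff.1 huc η hη
  refine ⟨min δ (e / 2), by positivity, fun τ hτ hτd X hX => ?_⟩
  have hmem : ∀ s ∈ Icc (X.2 - τ) X.2, (X.1, s) ∈ cthickening δ K := fun s hs => by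
    refine mem_cthickening_of_dist_le (X.1, s) X δ K hX ?_
    rw [Prod.dist_eq, dist_self, Real.dist_eq]
    refine max_le hδ.le (abs_le.2 ⟨?_, ?_⟩) <;>
      linarith [hs.1, hs.2, hτd.trans (min_le_left _ _)]
  have hder : ∀ s ∈ Icc (X.2 - τ) X.2, HasDerivAt (fun t => v (X.1, t)) (vt (X.1, s)) s :=
    fun s hs => hvt _ (hδΩ (hmem s hs))
  obtain ⟨c, hc, hc'⟩ := exists_hasDerivAt_eq_slope (fun t => v (X.1, t))
    (fun s => vt (X.1, s)) (show X.2 - τ < X.2 by linarith)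
    (fun s hs => (hder s hs).continuousAt.continuousWithinAt)
    (fun s hs => hder s (Ioo_subset_Icc_self hs))
  have hcX : dist (X.1, c) X < e := by
    rw [Prod.dist_eq, dist_self, Real.dist_eq]
    refine max_lt he (abs_lt.2 ⟨?_, ?_⟩) <;>
      linarith [hc.1, hc.2, hτd.trans (min_le_right _ _)]
  have h1 := hve (X.1, c) (hmem c (Ioo_subset_Icc_self hc)) X (self_subset_cthickening K hX) hcX
  rw [Real.dist_eq] at h1
  have h2 := (abs_lt.1 h1).2
  rw [eq_div_iff (by linarith)] at hc'
  have : v X - v (X.1, X.2 - τ) = vt (X.1, c) * τ := by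
    have : v X = v (X.1, X.2) := rfl
    linarith
  rw [this, mul_comm]
  exact mul_le_mul_of_nonneg_left (by linarith) hτ.le

end ContactSet

/-! ### The parabolic ABP estimate -/

section ABP

variable {E : Type*} [NormedAddCommGroup E] [InnerProductSpace ℝ E]

/-- The relevant part of the upper contact set of `v`: points of `K` at which `v` is
almost nondecreasing in time and concave in space up to second order. -/
def contactSet (vt : E × ℝ → ℝ) (H : E × ℝ → E →L[ℝ] E) (η : ℝ) (K : Set (E × ℝ)) :
    Set (E × ℝ) :=
  {X ∈ K | 0 ≤ vt X + η ∧ ∀ z, inner ℝ (H X z) z ≤ 0}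

theorem isClosed_contactSet {vt : E × ℝ → ℝ} {H : E × ℝ → E →L[ℝ] E} {η : ℝ} {K : Set (E × ℝ)}
    (hK : IsClosed K) (hvt : ContinuousOn vt K) (hH : ContinuousOn H K) :
    IsClosed (contactSet vt H η K) := by
  have h1 := (hvt.add_const η).preimage_isClosed_of_isClosed hK (isClosed_Ici (a := (0 : ℝ)))
  have h2 : ∀ z, IsClosed (K ∩ (fun X => inner ℝ (H X z) z) ⁻¹' Iic (0 : ℝ)) := fun z => by
    have : ContinuousOn (fun X => inner ℝ (H X z) z) K :=
      ContinuousOn.inner (𝕜 := ℝ) (hH.clm_apply continuousOn_const) continuousOn_const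
    exact this.preimage_isClosed_of_isClosed hK isClosed_Iic
  have : contactSet vt H η K = (K ∩ (fun X => vt X + η) ⁻¹' Ici 0) ∩
      ⋂ z, (K ∩ (fun X => inner ℝ (H X z) z) ⁻¹' Iic (0 : ℝ)) := by
    ext X; simp only [contactSet, mem_ofPred_eq, mem_inter_iff, mem_preimage, mem_Ici, mem_iInter,
      mem_Iic]
    constructor
    · rintro ⟨a, b, c⟩; exact ⟨⟨a, b⟩, fun z => ⟨a, c z⟩⟩
    · rintro ⟨⟨a, b⟩, c⟩; exact ⟨a, b, fun z => (c z).2⟩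
  rw [this]
  exact h1.inter (isClosed_iInter h2)

variable [FiniteDimensional ℝ E] [MeasurableSpace E] [BorelSpace E]

/-- The Aleksandrov–Bakelman–Pucci–Krylov–Tso estimate on a cylinder, in the form of a lower
bound for the integral of `(v_t + η) |det D²v|` over the contact set. -/
theorem parabolic_abp {v vt : E × ℝ → ℝ} {g : E × ℝ → E} {H : E × ℝ → E →L[ℝ] E}
    {y x₀ : E} {r a b t₀ m η : ℝ} (hr : 0 < r) (hat : a < t₀) (htb : t₀ < b)
    (hv : Continuous v)
    (hvt : ∀ X ∈ ball y r ×ˢ Ioo a b, HasDerivAt (fun t => v (X.1, t)) (vt X) X.2)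
    (hvg : ∀ X ∈ ball y r ×ˢ Ioo a b,
      HasFDerivAt (fun x => v (x, X.2)) (innerSL ℝ (g X)) X.1)
    (hgH : ∀ X ∈ ball y r ×ˢ Ioo a b, HasFDerivAt (fun x => g (x, X.2)) (H X) X.1)
    (hvtc : ContinuousOn vt (ball y r ×ˢ Ioo a b)) (hHc : ContinuousOn H (ball y r ×ˢ Ioo a b))
    (hx₀ : x₀ ∈ ball y r) (hm : 0 < m) (hmv : v (x₀, t₀) = m)
    (hbot : ∀ x ∈ closedBall y r, v (x, a) ≤ 0)
    (hlat : ∀ x ∈ sphere y r, ∀ t ∈ Icc a t₀, v (x, t) ≤ 0) (hη : 0 < η) :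
    ∃ Q : Set (E × ℝ), IsClosed Q ∧ Q ⊆ ball y r ×ˢ Ioc a t₀ ∧
      (∀ X ∈ Q, 0 < v X ∧ 0 ≤ vt X + η ∧ ∀ z, inner ℝ (H X z) z ≤ 0) ∧
      ENNReal.ofReal (m / 4) * volume (ball (0 : E) (m / (8 * r))) ≤
        ∫⁻ X in Q, ENNReal.ofReal |(H X).det| * ENNReal.ofReal (vt X + η) := by
  set Ω := ball y r ×ˢ Ioo a b with hΩdef
  have hΩ : IsOpen Ω := isOpen_ball.prod isOpen_Ioo
  set Kbar : Set (E × ℝ) := closedBall y r ×ˢ Icc a t₀ with hKbar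
  have hKbarc : IsCompact Kbar := (isCompact_closedBall y r).prod isCompact_Icc
  -- The level m/4 is the truncation height m/2 used below minus the largest tilt m/4. Being
  -- positive, it keeps K away from the bottom and the lateral boundary.
  set K : Set (E × ℝ) := Kbar ∩ {X | m / 4 ≤ v X} with hKdef
  have hKc : IsCompact K := hKbarc.inter_right (isClosed_le continuous_const hv)
  have hKsub : K ⊆ ball y r ×ˢ Ioc a t₀ := by
    rintro ⟨x, t⟩ ⟨⟨hx, ht⟩, hvx⟩
    simp only [mem_ofPred_eq] at hvx
    refine ⟨?_, lt_of_le_of_ne ht.1 ?_, ht.2⟩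
    · by_contra hx'
      have : x ∈ sphere y r := by
        simp only [mem_closedBall, mem_ball, not_lt, mem_sphere] at *
        exact le_antisymm hx hx'
      linarith [hlat x this t ht]
    · rintro rfl
      linarith [hbot x hx]
  have hKΩ : K ⊆ Ω := fun X hX =>
    ⟨(hKsub hX).1, (hKsub hX).2.1, (hKsub hX).2.2.trans_lt htb⟩
  set Q := contactSet vt H η K with hQdef
  have hQK : Q ⊆ K := fun X hX => hX.1
  have hQ : IsClosed Q := isClosed_contactSet hKc.isClosed (hvtc.mono hKΩ) (hHc.mono hKΩ)
  refine ⟨Q, hQ, hQK.trans hKsub, fun X hX => ⟨lt_of_lt_of_le (by positivity) hX.1.2, hX.2⟩, ?_⟩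
  have hQm : MeasurableSet Q := hQ.measurableSet
  -- the Legendre-type transform in space and its truncation
  set G : E → ℝ → ℝ := fun ξ t =>
    sSup ((fun x => v (x, t) - inner ℝ ξ (x - x₀)) '' closedBall y r) with hG
  have hcontx : ∀ ξ t, Continuous fun x => v (x, t) - inner ℝ ξ (x - x₀) := fun ξ t => by
    fun_prop
  have hGc : Continuous fun p : E × ℝ => G p.1 p.2 := by
    refine IsCompact.continuous_sSup
      (f := fun (p : E × ℝ) (x : E) => v (x, p.2) - inner ℝ p.1 (x - x₀))
      (isCompact_closedBall y r) ?_
    simp only [Function.HasUncurry.uncurry, id]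
    fun_prop
  have hGle : ∀ ξ t, ∀ x ∈ closedBall y r, v (x, t) - inner ℝ ξ (x - x₀) ≤ G ξ t :=
    fun ξ t x hx => le_csSup ((isCompact_closedBall y r).image (hcontx ξ t)).bddAbove
      (mem_image_of_mem _ hx)
  have hGatt : ∀ ξ t, ∃ x ∈ closedBall y r, G ξ t = v (x, t) - inner ℝ ξ (x - x₀) :=
    fun ξ t => (isCompact_closedBall y r).exists_sSup_image_eq
      (nonempty_closedBall.2 hr.le) (hcontx ξ t).continuousOn
  set h : E → ℝ → ℝ := fun ξ t => max (G ξ t) (m / 2) with hh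
  have hhc : Continuous fun p : E × ℝ => h p.1 p.2 := hGc.max continuous_const
  -- Points of the ball are within 2r of x₀, so slopes below m/(8r) tilt v by at most m/4.
  set B : Set E := ball 0 (m / (8 * r)) with hB
  have hinner : ∀ ξ ∈ B, ∀ x ∈ closedBall y r, |inner ℝ ξ (x - x₀)| ≤ m / 4 := by
    intro ξ hξ x hx
    have h1 : ‖ξ‖ ≤ m / (8 * r) := by simpa [hB] using (mem_ball_zero_iff.1 hξ).le
    have h2 : ‖x - x₀‖ ≤ 2 * r := by
      rw [← dist_eq_norm]
      have := dist_triangle_right x x₀ y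
      rw [mem_closedBall] at hx
      rw [mem_ball] at hx₀
      linarith
    calc |inner ℝ ξ (x - x₀)| ≤ ‖ξ‖ * ‖x - x₀‖ := abs_real_inner_le_norm _ _
      _ ≤ m / (8 * r) * (2 * r) := by gcongr
      _ = m / 4 := by field_simp; norm_num
  obtain ⟨d, hd, hdiff⟩ := exists_forall_sub_le_mul_timeDeriv hvt hvtc hKc hΩ hKΩ hη
  obtain ⟨δ, hδ, huc⟩ := Metric.uniformContinuousOn_iff.1
    (hKbarc.uniformContinuousOn_of_continuous hv.continuousOn) (m / 4) (by positivity)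
  -- The time step is fixed once and for all: at most d for the difference quotients, below δ so
  -- that v varies by less than m/4 during it. No limit Δ → 0 is needed.
  obtain ⟨Δ, hΔ, hΔd, hΔδ, hΔt⟩ : ∃ Δ > 0, Δ ≤ d ∧ Δ < δ ∧ a + Δ < t₀ :=
    ⟨min d (min (δ / 2) ((t₀ - a) / 2)), by
      have : 0 < t₀ - a := by linarith
      positivity, min_le_left _ _,
      by linarith [(min_le_right d (min (δ / 2) ((t₀ - a) / 2))).trans (min_le_left _ _)],
      by linarith [(min_le_right d (min (δ / 2) ((t₀ - a) / 2))).trans (min_le_right _ _)]⟩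
  have huc' : ∀ x ∈ closedBall y r, ∀ t ∈ Icc a t₀, ∀ t' ∈ Icc a t₀, |t - t'| ≤ Δ →
      |v (x, t) - v (x, t')| < m / 4 := fun x hx t ht t' ht' htt => by
    have := huc (x, t) ⟨hx, ht⟩ (x, t') ⟨hx, ht'⟩ (by
      rw [Prod.dist_eq, dist_self, Real.dist_eq]
      exact max_lt hδ (htt.trans_lt hΔδ))
    rwa [Real.dist_eq] at this
  -- Near the bottom v < m/4, and the tilt adds at most m/4, so the truncation is active.
  have hhbot : ∀ ξ ∈ B, ∀ t ∈ Icc a (a + Δ), h ξ t = m / 2 := by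
    intro ξ hξ t ht
    refine max_eq_right ?_
    obtain ⟨x, hx, hxe⟩ := hGatt ξ t
    rw [hxe]
    have h1 := (abs_lt.1 (huc' x hx t ⟨ht.1, by linarith [ht.2]⟩ a ⟨le_rfl, hat.le⟩
      (abs_le.2 ⟨by linarith [ht.1], by linarith [ht.2]⟩))).2
    have h2 := (abs_le.1 (hinner ξ hξ x hx)).1
    linarith [hbot x hx]
  -- Testing with x₀, where the tilt vanishes, gives more than m - m/4.
  have hhtop : ∀ ξ, ∀ t ∈ Icc (t₀ - Δ) t₀, 3 * m / 4 ≤ h ξ t := by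
    intro ξ t ht
    refine le_max_of_le_left (le_trans ?_ (hGle ξ t x₀ (ball_subset_closedBall hx₀)))
    have h1 := (abs_lt.1 (huc' x₀ (ball_subset_closedBall hx₀) t ⟨by linarith [ht.1], ht.2⟩ t₀
      ⟨hat.le, le_rfl⟩ (abs_le.2 ⟨by linarith [ht.1], by linarith [ht.2]⟩))).1
    simp only [sub_self, inner_zero_right]
    linarith
  -- the increment of the truncated transform, slice by slice
  have hslice : ∀ t ∈ Ioc (a + Δ) t₀,
      ∫⁻ ξ in B, ENNReal.ofReal (max (h ξ t - h ξ (t - Δ)) 0) ≤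
        ∫⁻ x in {x | (x, t) ∈ Q},
          ENNReal.ofReal |(H (x, t)).det| * ENNReal.ofReal (Δ * (vt (x, t) + η)) := by
    intro t ht
    have htΩ : ∀ x, (x, t) ∈ Q → (x, t) ∈ Ω := fun x hx => hKΩ (hQK hx)
    have hmaps : ContinuousOn (fun x => vt (x, t)) {x | (x, t) ∈ Q} :=
      hvtc.comp (by fun_prop) htΩ
    refine lintegral_le_lintegral_mul_abs_det volume (hQ.preimage (by fun_prop : Continuous fun x : E => (x, t)))
      (Φ := fun x => g (x, t)) (fun x hx => (hgH _ (htΩ x hx)).hasFDerivWithinAt)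
      (w := fun x => Δ * (vt (x, t) + η)) ?_ (fun ξ => le_max_right _ _)
      (continuousOn_const.mul (hmaps.add_const η)) (fun x hx => mul_nonneg hΔ.le hx.2.1) ?_
    · have : Continuous fun ξ => max (h ξ t - h ξ (t - Δ)) 0 :=
        ((hhc.comp (by fun_prop : Continuous fun ξ : E => (ξ, t))).sub
          (hhc.comp (by fun_prop : Continuous fun ξ : E => (ξ, t - Δ)))).max continuous_const
      exact this.measurable
    · intro ξ hξ hpos
      have hpos' : 0 < h ξ t - h ξ (t - Δ) := by
        rcases lt_max_iff.1 hpos with h | h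
        · exact h
        · exact absurd h (lt_irrefl _)
      have hlow : m / 2 ≤ h ξ (t - Δ) := le_max_right _ _
      -- An increase of `h` means that the truncation is inactive at time t. Hence a maximizer x has
      -- v > m/4, lies in K, and is an interior maximum with gradient ξ.
      have hGt : m / 2 < G ξ t := by
        by_contra! hle
        have : h ξ t = m / 2 := max_eq_right hle
        linarith
      have hht : h ξ t = G ξ t := max_eq_left hGt.le
      obtain ⟨x, hx, hxe⟩ := hGatt ξ t
      have hin := abs_le.1 (hinner ξ hξ x hx)
      have hxK : (x, t) ∈ K := ⟨⟨hx, by linarith [ht.1], ht.2⟩, by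
        simp only [mem_ofPred_eq]; linarith⟩
      have hxΩ := hKΩ hxK
      -- Using the same x as a competitor at time t - Δ bounds the increase of the supremum by that
      -- of v at x.
      have hinc : max (h ξ t - h ξ (t - Δ)) 0 ≤ Δ * (vt (x, t) + η) := by
        rw [max_eq_left hpos'.le]
        refine le_trans ?_ (hdiff Δ hΔ hΔd (x, t) hxK)
        have h1 := hGle ξ (t - Δ) x hx
        have h2 : G ξ (t - Δ) ≤ h ξ (t - Δ) := le_max_left _ _
        rw [hht, hxe]
        dsimp only
        linarith
      have hnh : ∀ᶠ z in nhds x, z ∈ ball y r := isOpen_ball.mem_nhds hxΩ.1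
      obtain ⟨hgx, hHx⟩ := IsLocalMax.gradient_eq_and_hessian_nonpos
        (f := fun z => v (z, t)) (g := fun z => g (z, t)) (H := H (x, t)) (x := x) (ξ := ξ)
        (by filter_upwards [hnh] with z hz using hvg (z, t) ⟨hz, hxΩ.2⟩) (hgH _ hxΩ) (by
          filter_upwards [hnh] with z hz
          have h1 := hGle ξ t z (ball_subset_closedBall hz)
          rw [hxe] at h1
          simp only [inner_sub_right] at h1
          linarith)
      refine ⟨x, ⟨hxK, ?_, hHx⟩, hgx, hinc⟩
      exact nonneg_of_mul_nonneg_right ((le_max_right _ _).trans hinc) hΔ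
  -- telescoping in time
  have htele : ∀ ξ ∈ B, ENNReal.ofReal (Δ * (m / 4)) ≤
      ∫⁻ t in Ioc (a + Δ) t₀, ENNReal.ofReal (max (h ξ t - h ξ (t - Δ)) 0) := by
    intro ξ hξ
    have hc : Continuous (h ξ) := hhc.comp (by fun_prop : Continuous fun t : ℝ => (ξ, t))
    have hc' : Continuous fun t => h ξ (t - Δ) := hc.comp (by fun_prop)
    have hii : ∀ s s', IntervalIntegrable (h ξ) volume s s' := fun s s' => hc.intervalIntegrable s s'
    have hmaxc : Continuous fun t => max (h ξ t - h ξ (t - Δ)) 0 := (hc.sub hc').max continuous_const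
    rw [← ofReal_integral_eq_lintegral_ofReal (hmaxc.integrableOn_Ioc)
      (Filter.Eventually.of_forall fun t => le_max_right _ _),
      ← intervalIntegral.integral_of_le hΔt.le]
    refine ENNReal.ofReal_le_ofReal ?_
    have h1 : ∫ t in (a + Δ)..t₀, (h ξ t - h ξ (t - Δ)) ≤
        ∫ t in (a + Δ)..t₀, max (h ξ t - h ξ (t - Δ)) 0 :=
      intervalIntegral.integral_mono_on hΔt.le ((hc.sub hc').intervalIntegrable _ _)
        (hmaxc.intervalIntegrable _ _) fun t _ => le_max_left _ _
    -- After a shift of the second integral only the two end strips of width Δ survive; they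
    -- contribute at least Δ(3m/4 - m/2) = Δ m/4.
    have h2 : ∫ t in (a + Δ)..t₀, (h ξ t - h ξ (t - Δ)) =
        (∫ t in (t₀ - Δ)..t₀, h ξ t) - ∫ t in a..(a + Δ), h ξ t := by
      rw [intervalIntegral.integral_sub (hii _ _) (hc'.intervalIntegrable _ _),
        intervalIntegral.integral_comp_sub_right (h ξ), add_sub_cancel_right]
      have e1 := intervalIntegral.integral_add_adjacent_intervals (hii a (a + Δ)) (hii (a + Δ) t₀)
      have e2 := intervalIntegral.integral_add_adjacent_intervals (hii a (t₀ - Δ)) (hii (t₀ - Δ) t₀)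
      linarith
    have h3 : Δ * (3 * m / 4) ≤ ∫ t in (t₀ - Δ)..t₀, h ξ t := by
      have := intervalIntegral.integral_mono_on (show t₀ - Δ ≤ t₀ by linarith)
        (intervalIntegrable_const (c := 3 * m / 4)) (hii _ _) (hhtop ξ)
      rw [intervalIntegral.integral_const, smul_eq_mul, sub_sub_cancel] at this
      exact this
    have h4 : ∫ t in a..(a + Δ), h ξ t = Δ * (m / 2) := by
      rw [intervalIntegral.integral_congr (g := fun _ => m / 2)]
      · rw [intervalIntegral.integral_const, smul_eq_mul, add_sub_cancel_left]
      · intro t ht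
        rw [uIcc_of_le (by linarith)] at ht
        exact hhbot ξ hξ t ht
    rw [h4] at h2
    linarith
  have hFm : AEMeasurable (fun X => ENNReal.ofReal |(H X).det| * ENNReal.ofReal (vt X + η))
      (volume.restrict Q) := by
    have h1 : ContinuousOn (fun X => |(H X).det|) Q :=
      (ContinuousLinearMap.continuous_det.comp_continuousOn (hHc.mono (hQK.trans hKΩ))).abs
    have h2 : ContinuousOn (fun X => vt X + η) Q := (hvtc.mono (hQK.trans hKΩ)).add_const η
    exact (h1.aemeasurable hQm).ennreal_ofReal.mul (h2.aemeasurable hQm).ennreal_ofReal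
  have hΔ0 : ENNReal.ofReal Δ ≠ 0 := by simpa using hΔ
  rw [← ENNReal.mul_le_mul_iff_right hΔ0 ENNReal.ofReal_ne_top]
  calc ENNReal.ofReal Δ * (ENNReal.ofReal (m / 4) * volume B)
      = ∫⁻ _ in B, ENNReal.ofReal (Δ * (m / 4)) := by
        rw [setLIntegral_const, ENNReal.ofReal_mul hΔ.le, mul_assoc]
    _ ≤ ∫⁻ ξ in B, ∫⁻ t in Ioc (a + Δ) t₀, ENNReal.ofReal (max (h ξ t - h ξ (t - Δ)) 0) :=
        setLIntegral_mono' measurableSet_ball htele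
    _ = ∫⁻ t in Ioc (a + Δ) t₀, ∫⁻ ξ in B, ENNReal.ofReal (max (h ξ t - h ξ (t - Δ)) 0) := by
        refine lintegral_lintegral_swap (Continuous.aemeasurable ?_)
        refine ENNReal.continuous_ofReal.comp ((hhc.sub ?_).max continuous_const)
        exact hhc.comp (by fun_prop : Continuous fun p : E × ℝ => (p.1, p.2 - Δ))
    _ ≤ ∫⁻ t in Ioc (a + Δ) t₀, ∫⁻ x in {x | (x, t) ∈ Q},
          ENNReal.ofReal |(H (x, t)).det| * ENNReal.ofReal (Δ * (vt (x, t) + η)) :=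
        setLIntegral_mono' measurableSet_Ioc hslice
    _ ≤ ∫⁻ t, ∫⁻ x in {x | (x, t) ∈ Q},
          ENNReal.ofReal |(H (x, t)).det| * ENNReal.ofReal (Δ * (vt (x, t) + η)) :=
        setLIntegral_le_lintegral _ _
    _ = ∫⁻ t, ∫⁻ x, Q.indicator (fun X => ENNReal.ofReal Δ *
          (ENNReal.ofReal |(H X).det| * ENNReal.ofReal (vt X + η))) (x, t) := by
        refine lintegral_congr fun t => ?_
        have hQt : MeasurableSet {x | (x, t) ∈ Q} :=
          (hQ.preimage (by fun_prop : Continuous fun x : E => (x, t))).measurableSet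
        rw [← lintegral_indicator hQt]
        refine lintegral_congr fun x => ?_
        by_cases hx : (x, t) ∈ Q
        · rw [indicator_of_mem (by exact hx), indicator_of_mem hx, ENNReal.ofReal_mul hΔ.le]
          ring
        · rw [indicator_of_notMem (by exact hx), indicator_of_notMem hx]
    _ = ∫⁻ X, Q.indicator (fun X => ENNReal.ofReal Δ *
          (ENNReal.ofReal |(H X).det| * ENNReal.ofReal (vt X + η))) X := by
        rw [Measure.volume_eq_prod, lintegral_prod_symm]
        rw [← Measure.volume_eq_prod]
        exact (aemeasurable_indicator_iff hQm).2 (hFm.const_mul _)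
    _ = ENNReal.ofReal Δ * ∫⁻ X in Q,
          ENNReal.ofReal |(H X).det| * ENNReal.ofReal (vt X + η) := by
        rw [lintegral_indicator hQm, lintegral_const_mul'' _ hFm]

end ABP

/-! ### From partial derivatives to Fréchet derivatives -/

section Partials

variable {n : ℕ}

/-- A function on `ℝⁿ` whose partial derivatives exist near `x` and are continuous at `x` is
differentiable at `x`. -/
theorem hasFDerivAt_of_continuousAt_lineDeriv {f : EuclideanSpace ℝ (Fin n) → ℝ}
    {D : Fin n → EuclideanSpace ℝ (Fin n) → ℝ} {x : EuclideanSpace ℝ (Fin n)}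
    (hf : ∀ᶠ z in nhds x, ∀ i, HasLineDerivAt ℝ f (D i z) z (EuclideanSpace.single i 1))
    (hD : ∀ i, ContinuousAt (D i) x) :
    HasFDerivAt f (innerSL ℝ (WithLp.toLp 2 fun i => D i x)) x := by
  rw [hasFDerivAt_iff_isLittleO_nhds_zero, Asymptotics.isLittleO_iff]
  intro c hc
  set ε : ℝ := c / (n + 1) with hε
  have hεpos : 0 < ε := by positivity
  have hev : ∀ᶠ z in nhds x, (∀ i, HasLineDerivAt ℝ f (D i z) z (EuclideanSpace.single i 1)) ∧
      ∀ i, |D i z - D i x| ≤ ε := by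
    refine hf.and (Filter.eventually_all.2 fun i => ?_)
    have := (hD i).eventually (Metric.closedBall_mem_nhds _ hεpos)
    filter_upwards [this] with z hz
    simpa [Real.dist_eq] using hz
  obtain ⟨δ, hδ, hball⟩ := Metric.eventually_nhds_iff_ball.1 hev
  -- Then Σ|hᵢ| < δ, so the path that changes one coordinate at a time stays in the ball where the
  -- partials are ε-close to their values at x.
  have hsmall : ∀ᶠ h : EuclideanSpace ℝ (Fin n) in nhds 0, ‖h‖ < δ / (n + 1) := by
    filter_upwards [Metric.ball_mem_nhds (0 : EuclideanSpace ℝ (Fin n))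
      (show 0 < δ / (n + 1) by positivity)] with h hh
    simpa using hh
  filter_upwards [hsmall] with h hh
  have hcoord : ∀ i, |h i| ≤ ‖h‖ := fun i => by
    simpa using PiLp.norm_apply_le h i
  set e : Fin n → EuclideanSpace ℝ (Fin n) := fun i => EuclideanSpace.single i 1 with he
  have he1 : ∀ i, ‖e i‖ = 1 := fun i => by simp [he]
  have hnorm : ∀ s : Finset (Fin n), ∑ i ∈ s, |h i| < δ := fun s => by
    have h1 : ∑ i ∈ s, |h i| ≤ ∑ i : Fin n, ‖h‖ :=
      (Finset.sum_le_sum_of_subset_of_nonneg (Finset.subset_univ s) fun i _ _ =>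
        abs_nonneg _).trans (Finset.sum_le_sum fun i _ => hcoord i)
    rw [Finset.sum_const, Finset.card_univ, Fintype.card_fin, nsmul_eq_mul] at h1
    rw [lt_div_iff₀ (by positivity)] at hh
    have := norm_nonneg h
    nlinarith
  -- Induction on the coordinates already moved; each new one costs ε‖h‖ by the mean value
  -- inequality, and the n of them cost at most c‖h‖.
  have key : ∀ s : Finset (Fin n),
      |f (x + ∑ i ∈ s, h i • e i) - f x - ∑ i ∈ s, h i * D i x| ≤ s.card * (ε * ‖h‖) := by
    intro s
    induction s using Finset.induction_on with
    | empty => simp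
    | insert i s hi ih =>
      set q := x + ∑ j ∈ s, h j • e j with hq
      have hmem : ∀ σ ∈ Icc (0 : ℝ) 1, q + σ • (h i • e i) ∈ ball x δ := by
        intro σ hσ
        rw [mem_ball, dist_eq_norm, hq]
        have e1 : x + ∑ j ∈ s, h j • e j + σ • h i • e i - x =
            ∑ j ∈ s, h j • e j + σ • h i • e i := by abel
        rw [e1]
        refine lt_of_le_of_lt ?_ (hnorm (insert i s))
        rw [Finset.sum_insert hi, add_comm |h i|]
        refine (norm_add_le _ _).trans (add_le_add ((norm_sum_le _ _).trans
          (Finset.sum_le_sum fun j _ => by rw [norm_smul, he1, mul_one, Real.norm_eq_abs])) ?_)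
        rw [norm_smul, norm_smul, he1, mul_one, Real.norm_eq_abs, Real.norm_eq_abs,
          abs_of_nonneg hσ.1]
        exact mul_le_of_le_one_left (abs_nonneg _) hσ.2
      have hder : ∀ σ ∈ Icc (0 : ℝ) 1, HasDerivWithinAt
          (fun σ : ℝ => f (q + σ • (h i • e i)) - σ * (h i * D i x))
          (h i * D i (q + σ • (h i • e i)) - h i * D i x) (Icc 0 1) σ := by
        intro σ hσ
        have h1 : HasLineDerivAt ℝ f (h i • D i (q + σ • (h i • e i))) (q + σ • (h i • e i))
            (h i • e i) := ((hball _ (hmem σ hσ)).1 i).smul (h i)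
        have h2 : HasDerivAt (fun τ : ℝ => f (q + σ • (h i • e i) + (τ - σ) • (h i • e i)))
            (h i * D i (q + σ • (h i • e i))) σ := by
          have h3 := h1
          unfold HasLineDerivAt at h3
          rw [← sub_self σ] at h3
          simpa using h3.comp_sub_const σ σ
        have h4 : (fun τ : ℝ => f (q + σ • (h i • e i) + (τ - σ) • (h i • e i))) =
            fun τ : ℝ => f (q + τ • (h i • e i)) := by
          ext τ; congr 1; rw [add_assoc, ← add_smul]; congr 2; ring
        rw [h4] at h2
        have h5 := h2.sub ((hasDerivAt_id σ).mul_const (h i * D i x))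
        rw [one_mul] at h5
        exact h5.hasDerivWithinAt
      have hstep := norm_image_sub_le_of_norm_deriv_le_segment_01' hder
        (C := ε * ‖h‖) (fun σ hσ => by
          rw [← mul_sub, Real.norm_eq_abs, abs_mul, mul_comm]
          exact mul_le_mul ((hball _ (hmem σ (Ico_subset_Icc_self hσ))).2 i) (hcoord i)
            (abs_nonneg _) hεpos.le)
      rw [Finset.sum_insert hi, Finset.sum_insert hi, Finset.card_insert_of_notMem hi]
      have e2 : x + (h i • e i + ∑ j ∈ s, h j • e j) = q + h i • e i := by rw [hq]; abel
      rw [e2]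
      simp only [one_smul, zero_smul, add_zero, one_mul, zero_mul, sub_zero,
        Real.norm_eq_abs] at hstep
      push_cast
      rw [abs_le] at *
      constructor <;> linarith [ih.1, ih.2, hstep.1, hstep.2]
  have hsum : ∑ i, h i • e i = h := by
    ext j
    simp [he, Finset.sum_apply, Pi.single_apply]
  have hfin := key Finset.univ
  rw [hsum, Finset.card_univ, Fintype.card_fin] at hfin
  have hin : (innerSL ℝ (WithLp.toLp 2 fun i => D i x)) h = ∑ i, h i * D i x := by
    simp [PiLp.inner_apply]
  rw [hin, Real.norm_eq_abs]
  refine hfin.trans ?_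
  rw [← mul_assoc]
  refine mul_le_mul_of_nonneg_right ?_ (norm_nonneg _)
  rw [hε, ← mul_div_assoc, div_le_iff₀ (by positivity)]
  nlinarith

/-- The spatial gradient of `u`. -/
def spaceGrad (u : SpaceTime n → ℝ) (X : SpaceTime n) : EuclideanSpace ℝ (Fin n) :=
  WithLp.toLp 2 fun i => spaceDeriv i u X

/-- The spatial Hessian of `u`, as a matrix. -/
def spaceHess (u : SpaceTime n → ℝ) (X : SpaceTime n) : Matrix (Fin n) (Fin n) ℝ :=
  Matrix.of fun i j => spaceDeriv₂ j i u X

variable {u : SpaceTime n → ℝ} {Ω : Set (SpaceTime n)}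

theorem eventually_slice_mem {E : Type*} [TopologicalSpace E] {Ω : Set (E × ℝ)} (hΩ : IsOpen Ω)
    {X : E × ℝ} (hX : X ∈ Ω) : ∀ᶠ z in nhds X.1, (z, X.2) ∈ Ω :=
  (show Continuous fun z => (z, X.2) by fun_prop).continuousAt.eventually
    (hΩ.mem_nhds (show (X.1, X.2) ∈ Ω from hX))

theorem continuousAt_slice {E : Type*} [TopologicalSpace E] {Ω : Set (E × ℝ)} (hΩ : IsOpen Ω)
    {X : E × ℝ} (hX : X ∈ Ω) {f : E × ℝ → ℝ} (hf : ContinuousOn f Ω) :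
    ContinuousAt (fun z => f (z, X.2)) X.1 :=
  ContinuousAt.comp (f := fun z => (z, X.2)) (g := f) (hf.continuousAt (hΩ.mem_nhds hX))
    (show Continuous fun z => (z, X.2) by fun_prop).continuousAt

theorem IsC21On.hasFDerivAt (hu : IsC21On u Ω) (hΩ : IsOpen Ω) {X : SpaceTime n} (hX : X ∈ Ω) :
    HasFDerivAt (fun x => u (x, X.2)) (innerSL ℝ (spaceGrad u X)) X.1 := by
  refine hasFDerivAt_of_continuousAt_lineDeriv (D := fun i z => spaceDeriv i u (z, X.2)) ?_
    fun i => continuousAt_slice hΩ hX (hu.space_continuousOn i)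
  filter_upwards [eventually_slice_mem hΩ hX] with z hz i
  exact (hu.space_differentiable i (z, X.2) hz).hasLineDerivAt

theorem IsC21On.hasFDerivAt_spaceGrad (hu : IsC21On u Ω) (hΩ : IsOpen Ω) {X : SpaceTime n}
    (hX : X ∈ Ω) :
    HasFDerivAt (fun x => spaceGrad u (x, X.2))
      (Matrix.toEuclideanCLM (𝕜 := ℝ) (spaceHess u X)) X.1 := by
  rw [← hasFDerivWithinAt_univ, hasFDerivWithinAt_euclidean]
  intro i
  have := hasFDerivAt_of_continuousAt_lineDeriv (f := fun z => spaceDeriv i u (z, X.2))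
    (D := fun j z => spaceDeriv₂ j i u (z, X.2)) (x := X.1) (by
      filter_upwards [eventually_slice_mem hΩ hX] with z hz j
      exact (hu.space₂_differentiable j i (z, X.2) hz).hasLineDerivAt)
    fun j => continuousAt_slice hΩ hX (hu.space₂_continuousOn j i)
  refine (this.congr_fderiv ?_).hasFDerivWithinAt
  ext z
  simp [PiLp.inner_apply, spaceHess, Matrix.mulVec, dotProduct, mul_comm]

theorem IsC21On.continuousOn_spaceHess (hu : IsC21On u Ω) :
    ContinuousOn (spaceHess u) Ω :=
  continuousOn_pi.2 fun i => continuousOn_pi.2 fun j => hu.space₂_continuousOn j i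

theorem IsC21On.inner_spaceHess_comm (hu : IsC21On u Ω) (hΩ : IsOpen Ω) {X : SpaceTime n}
    (hX : X ∈ Ω) (z w : EuclideanSpace ℝ (Fin n)) :
    inner ℝ (Matrix.toEuclideanCLM (𝕜 := ℝ) (spaceHess u X) z) w =
      inner ℝ (Matrix.toEuclideanCLM (𝕜 := ℝ) (spaceHess u X) w) z := by
  -- The Riesz map as a genuinely ℝ-linear map, since `innerSL` is typed as conjugate-linear; it
  -- turns the gradient into the Fréchet derivative.
  let J : EuclideanSpace ℝ (Fin n) →L[ℝ] EuclideanSpace ℝ (Fin n) →L[ℝ] ℝ :=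
    LinearMap.toContinuousLinearMap
      { toFun := fun a => innerSL ℝ a, map_add' := by simp, map_smul' := by simp }
  have h1 : ∀ᶠ z in nhds X.1, HasFDerivAt (fun x => u (x, X.2)) (J (spaceGrad u (z, X.2))) z := by
    filter_upwards [eventually_slice_mem hΩ hX] with z hz
    exact hu.hasFDerivAt hΩ hz
  have h2 := J.hasFDerivAt.comp X.1 (hu.hasFDerivAt_spaceGrad hΩ hX)
  simpa [J] using second_derivative_symmetric_of_eventually h1 h2 z w

end Partials

/-! ### Determinant, trace and ellipticity -/

section MatrixIneq

variable {n : ℕ}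

/-- Each eigenvalue is at most their sum. The factor n⁻ⁿ of the arithmetic–geometric mean inequality
is not needed. -/
theorem Matrix.PosSemidef.det_le_trace_pow {P : Matrix (Fin n) (Fin n) ℝ} (hP : P.PosSemidef) :
    P.det ≤ P.trace ^ n := by
  have hd := hP.isHermitian.det_eq_prod_eigenvalues
  have ht := hP.isHermitian.trace_eq_sum_eigenvalues
  simp only [RCLike.ofReal_real_eq_id, id] at hd ht
  rw [hd, ht]
  calc ∏ i, hP.isHermitian.eigenvalues i
      ≤ ∏ _i : Fin n, ∑ j, hP.isHermitian.eigenvalues j :=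
        Finset.prod_le_prod (fun i _ => hP.eigenvalues_nonneg i) fun i _ =>
          Finset.single_le_sum (fun j _ => hP.eigenvalues_nonneg j) (Finset.mem_univ i)
    _ = _ := by simp

/-- P is a sum of rank-one matrices v vᵀ, and ellipticity applies to each of them with ξ = v. -/
theorem Matrix.PosSemidef.mul_trace_le {P a : Matrix (Fin n) (Fin n) ℝ} (hP : P.PosSemidef)
    {ν : ℝ} (ha : ∀ ξ : EuclideanSpace ℝ (Fin n), ν * ‖ξ‖ ^ 2 ≤ ∑ i, ∑ j, a i j * ξ i * ξ j) :
    ν * P.trace ≤ ∑ i, ∑ j, a i j * P i j := by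
  obtain ⟨m, v, hv⟩ := Matrix.posSemidef_iff_eq_sum_vecMulVec.1 hP
  have hPij : ∀ i j, P i j = ∑ k, v k i * v k j := fun i j => by
    rw [hv, Matrix.sum_apply]; simp [Matrix.vecMulVec_apply]
  calc ν * P.trace = ∑ k, ν * ‖(WithLp.toLp 2 (v k) : EuclideanSpace ℝ (Fin n))‖ ^ 2 := by
        simp_rw [← Finset.mul_sum, EuclideanSpace.norm_sq_eq, Matrix.trace, Matrix.diag, hPij]
        rw [Finset.sum_comm]
        simp [sq]
    _ ≤ ∑ k, ∑ i, ∑ j, a i j * v k i * v k j := Finset.sum_le_sum fun k _ => ha _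
    _ = ∑ i, ∑ j, a i j * P i j := by
        rw [Finset.sum_comm]
        refine Finset.sum_congr rfl fun i _ => ?_
        rw [Finset.sum_comm]
        refine Finset.sum_congr rfl fun j _ => ?_
        rw [hPij, Finset.mul_sum]
        exact Finset.sum_congr rfl fun k _ => by ring

/-- Substitute for the arithmetic–geometric mean inequality for the parabolic operator. -/
theorem Matrix.PosSemidef.mul_det_le {P a : Matrix (Fin n) (Fin n) ℝ} (hP : P.PosSemidef)
    {ν w p F : ℝ} (hν : 0 < ν) (hw : 0 < w) (hp : 0 ≤ p)
    (ha : ∀ ξ : EuclideanSpace ℝ (Fin n), ν * ‖ξ‖ ^ 2 ≤ ∑ i, ∑ j, a i j * ξ i * ξ j)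
    (hF : p + w * ∑ i, ∑ j, a i j * P i j ≤ F) :
    P.det * p ≤ (ν ^ n)⁻¹ * (F ^ (n + 1) * (w ^ n)⁻¹) := by
  set q := ∑ i, ∑ j, a i j * P i j
  have htr : 0 ≤ P.trace := hP.trace_nonneg
  have hq : ν * P.trace ≤ q := hP.mul_trace_le ha
  have hq0 : 0 ≤ q := (mul_nonneg hν.le htr).trans hq
  have h1 : ν ^ n * w ^ n * (P.det * p) ≤ F ^ (n + 1) := by
    calc ν ^ n * w ^ n * (P.det * p) ≤ ν ^ n * w ^ n * (P.trace ^ n * p) := by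
          gcongr; exact hP.det_le_trace_pow
      _ = (w * (ν * P.trace)) ^ n * p := by ring
      _ ≤ (w * q) ^ n * p := by gcongr
      -- Both summands of p + wq are nonnegative, so each is at most F.
      _ ≤ F ^ n * F := by
          have : 0 ≤ w * q := mul_nonneg hw.le hq0
          have h3 : w * q ≤ F := by linarith
          have h4 : p ≤ F := by linarith
          exact mul_le_mul (pow_le_pow_left₀ this h3 n) h4 hp (pow_nonneg (this.trans h3) n)
      _ = F ^ (n + 1) := by ring
  rw [← mul_assoc, mul_comm (ν ^ n)⁻¹, mul_assoc, ← mul_inv, ← div_eq_mul_inv,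
    le_div_iff₀ (by positivity)]
  linarith

end MatrixIneq

/-! ### Averages of the weight and of its dual -/

section WeightFacts

variable {n : ℕ}

/-- Hölder's inequality for a weight and its dual weight. -/
theorem measure_univ_pow_le_lintegral_mul_lintegral_rpow_neg {α : Type*} [MeasurableSpace α]
    {μ : Measure α} {f : α → ℝ≥0∞} (hn : 1 ≤ n) (hf : AEMeasurable f μ)
    (h0 : ∀ᵐ x ∂μ, f x ≠ 0) (htop : ∀ᵐ x ∂μ, f x ≠ ∞) :
    μ univ ^ (n + 1) ≤ (∫⁻ x, f x ∂μ) ^ n * ∫⁻ x, f x ^ (-(n : ℝ)) ∂μ := by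
  have hn0 : (0 : ℝ) < n := by exact_mod_cast hn
  have hn1 : (0 : ℝ) < n + 1 := by positivity
  have hpq : Real.HolderConjugate ((n + 1 : ℝ) / n) (n + 1) := by
    rw [Real.holderConjugate_iff]
    refine ⟨by rw [lt_div_iff₀ hn0]; linarith, ?_⟩
    field_simp
  -- Hölder for 1 = f^{n/(n+1)} · f^{-n/(n+1)}, with exponents (n+1)/n and n+1.
  have hH := ENNReal.lintegral_mul_le_Lp_mul_Lq μ hpq (f := fun x => f x ^ ((n : ℝ) / (n + 1)))
    (g := fun x => (f x ^ (-(n : ℝ))) ^ (1 / ((n : ℝ) + 1))) (hf.pow_const _)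
    ((hf.pow_const _).pow_const _)
  have h1 : ∫⁻ x, ((fun x => f x ^ ((n : ℝ) / (n + 1))) *
      fun x => (f x ^ (-(n : ℝ))) ^ (1 / ((n : ℝ) + 1))) x ∂μ = μ univ := by
    rw [← lintegral_one]
    refine lintegral_congr_ae ?_
    filter_upwards [h0, htop] with x hx0 hxt
    simp only [Pi.mul_apply]
    rw [← ENNReal.rpow_mul, ← ENNReal.rpow_add _ _ hx0 hxt]
    convert ENNReal.rpow_zero
    field_simp
    ring
  have h2 : ∀ x, (f x ^ ((n : ℝ) / (n + 1))) ^ ((n + 1 : ℝ) / n) = f x := fun x => by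
    rw [← ENNReal.rpow_mul]
    convert ENNReal.rpow_one _
    field_simp
  have h3 : ∀ x, ((f x ^ (-(n : ℝ))) ^ (1 / ((n : ℝ) + 1))) ^ ((n : ℝ) + 1) =
      f x ^ (-(n : ℝ)) := fun x => by
    rw [← ENNReal.rpow_mul, one_div_mul_cancel hn1.ne', ENNReal.rpow_one]
  rw [h1] at hH
  simp only [h2, h3] at hH
  calc μ univ ^ (n + 1) ≤ _ := pow_le_pow_left' hH (n + 1)
    _ = _ := by
      rw [mul_pow, ← ENNReal.rpow_natCast, ← ENNReal.rpow_natCast _ (n + 1), ← ENNReal.rpow_mul,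
        ← ENNReal.rpow_mul]
      congr 1
      · rw [← ENNReal.rpow_natCast]
        congr 1
        push_cast
        field_simp
      · convert ENNReal.rpow_one _
        push_cast
        field_simp

variable {ω : EuclideanSpace ℝ (Fin n) → ℝ}

theorem IsMuckenhoupt.aemeasurable {p : ℝ} (hω : IsMuckenhoupt p ω) : AEMeasurable ω :=
  hω.locallyIntegrable.aestronglyMeasurable.aemeasurable

theorem IsMuckenhoupt.aemeasurable_dualWeight {p : ℝ} (hω : IsMuckenhoupt p ω) :
    AEMeasurable (dualWeight ω) :=
  hω.aemeasurable.ennreal_ofReal.pow_const _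

theorem dualWeight_eq_ofReal {x : EuclideanSpace ℝ (Fin n)} (hx : 0 < ω x) :
    dualWeight ω x = ENNReal.ofReal ((ω x ^ n)⁻¹) := by
  rw [dualWeight, ENNReal.ofReal_rpow_of_pos hx, Real.rpow_neg hx.le, Real.rpow_natCast]

/-- For an `A_{1+1/n}` weight on a ball `B`, the averages `α = (ω)_B` and `β = (ω^{-n})_B^{1/n}`
are positive and finite, and `1 ≤ α β ≤ K₀`. -/
theorem IsMuckenhoupt.exists_averages (hn : 1 ≤ n) (hω : IsMuckenhoupt (1 + 1 / (n : ℝ)) ω)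
    {K₀ : ℝ} (hK₀ : 1 ≤ K₀)
    (hK : muckenhouptConst (1 + 1 / (n : ℝ)) ω ≤ ENNReal.ofReal K₀)
    (y : EuclideanSpace ℝ (Fin n)) {r : ℝ} (hr : 0 < r) :
    ∃ α β : ℝ, 0 < α ∧ 0 < β ∧ 1 ≤ α * β ∧ α * β ≤ K₀ ∧
      ⨍ z in ball y r, ω z = α ∧
      (⨍⁻ x in ball y r, dualWeight ω x ∂volume).toReal ^ (1 / (n : ℝ)) = β ∧
      ∫⁻ x in ball y r, ENNReal.ofReal (ω x) = ENNReal.ofReal α * volume (ball y r) ∧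
      ∫⁻ x in ball y r, dualWeight ω x = ENNReal.ofReal (β ^ n) * volume (ball y r) := by
  have hn0 : (0 : ℝ) < n := by exact_mod_cast hn
  set B := ball y r
  have hc0 : volume B ≠ 0 := (measure_ball_pos _ _ hr).ne'
  have hct : volume B ≠ ∞ := measure_ball_lt_top.ne
  set W := ∫⁻ x in B, ENNReal.ofReal (ω x) with hW
  set U := ∫⁻ x in B, dualWeight ω x with hU
  have hint : IntegrableOn ω B :=
    (hω.locallyIntegrable.integrableOn_isCompact (isCompact_closedBall y r)).mono_set
      ball_subset_closedBall
  have hWt : W ≠ ∞ := hint.lintegral_lt_top.ne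
  -- This yields both the nonvanishing of the averages and αβ ≥ 1; finiteness of the dual average
  -- comes from the Muckenhoupt bound.
  have hHol : volume B ^ (n + 1) ≤ W ^ n * U := by
    have := measure_univ_pow_le_lintegral_mul_lintegral_rpow_neg (μ := volume.restrict B)
      (f := fun x => ENNReal.ofReal (ω x)) hn hω.aemeasurable.restrict.ennreal_ofReal
      (by filter_upwards [ae_restrict_of_ae hω.pos_ae] with x hx; simpa using hx)
      (Filter.Eventually.of_forall fun x => ENNReal.ofReal_ne_top)
    rwa [Measure.restrict_apply_univ] at this
  have hpos : W ^ n * U ≠ 0 := fun h0 => by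
    rw [h0] at hHol
    exact hc0 (eq_zero_of_pow_eq_zero (le_antisymm hHol bot_le))
  have hW0 : W ≠ 0 := fun h => hpos (by rw [h, zero_pow (by omega), zero_mul])
  have hU0 : U ≠ 0 := fun h => hpos (by rw [h, mul_zero])
  have hA : (W / volume B) * (U / volume B) ^ (1 / (n : ℝ)) ≤ ENNReal.ofReal K₀ := by
    refine le_trans ?_ hK
    refine le_trans (le_of_eq ?_) (le_iSup₂_of_le y r (le_iSup_of_le hr le_rfl))
    rw [setLAverage_eq, setLAverage_eq, add_sub_cancel_left,
      show -1 / (1 / (n : ℝ)) = -n by field_simp]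
    rfl
  have hWc0 : W / volume B ≠ 0 := ENNReal.div_ne_zero.2 ⟨hW0, hct⟩
  have hUt : U / volume B ≠ ∞ := fun h => by
    rw [h, ENNReal.top_rpow_of_pos (by positivity), ENNReal.mul_top hWc0] at hA
    exact ENNReal.ofReal_ne_top (le_antisymm le_top hA)
  have hUc0 : U / volume B ≠ 0 := ENNReal.div_ne_zero.2 ⟨hU0, hct⟩
  have hWct : W / volume B ≠ ∞ := ENNReal.div_ne_top hWt hc0
  set α := (W / volume B).toReal with hα
  set β := (U / volume B).toReal ^ (1 / (n : ℝ)) with hβ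
  have hα0 : 0 < α := ENNReal.toReal_pos hWc0 hWct
  have hβ0 : 0 < β := Real.rpow_pos_of_pos (ENNReal.toReal_pos hUc0 hUt) _
  have hβn : β ^ n = (U / volume B).toReal := by
    rw [hβ, ← Real.rpow_natCast, ← Real.rpow_mul ENNReal.toReal_nonneg,
      one_div_mul_cancel hn0.ne', Real.rpow_one]
  have hWe : W = ENNReal.ofReal α * volume B := by
    rw [hα, ENNReal.ofReal_toReal hWct, ENNReal.div_mul_cancel hc0 hct]
  have hUe : U = ENNReal.ofReal (β ^ n) * volume B := by
    rw [hβn, ENNReal.ofReal_toReal hUt, ENNReal.div_mul_cancel hc0 hct]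
  refine ⟨α, β, hα0, hβ0, ?_, ?_, ?_, ?_, hWe, hUe⟩
  · rw [hWe, hUe, mul_pow, mul_mul_mul_comm, ← pow_succ, ← ENNReal.ofReal_pow hα0.le,
      ← ENNReal.ofReal_mul (by positivity), ← mul_pow] at hHol
    have h1 : (1 : ℝ≥0∞) ≤ ENNReal.ofReal ((α * β) ^ n) := by
      rw [← ENNReal.mul_le_mul_iff_left (pow_ne_zero (n + 1) hc0) (ENNReal.pow_ne_top hct),
        one_mul]
      exact hHol
    rw [ENNReal.one_le_ofReal] at h1
    exact (one_le_pow_iff_of_nonneg (by positivity) (by omega)).1 h1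
  · have := ENNReal.toReal_mono ENNReal.ofReal_ne_top hA
    rwa [ENNReal.toReal_mul, ← ENNReal.toReal_rpow, ENNReal.toReal_ofReal (by linarith)] at this
  · rw [setAverage_eq, integral_eq_lintegral_of_nonneg_ae
      (Filter.Eventually.of_forall hω.nonneg) hint.aestronglyMeasurable, smul_eq_mul, hα,
      ENNReal.toReal_div, Measure.real, div_eq_inv_mul]
  · rw [setLAverage_eq]

/-- The ball itself competes in the supremum defining the seminorm; the denominator ω(B) becomes
α|B|. -/
theorem lintegral_rpow_oscillation_le {α ε : ℝ} {y : EuclideanSpace ℝ (Fin n)} {r : ℝ}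
    (hr : 0 < r) (hα : 0 < α) (hε : 0 < ε)
    (hW : ∫⁻ x in ball y r, ENNReal.ofReal (ω x) = ENNReal.ofReal α * volume (ball y r))
    (havg : ⨍ z in ball y r, ω z = α)
    (hBMO : weightedBMO ω ω (ball y r) ≤ ENNReal.ofReal ε) :
    ∫⁻ x in ball y r, ENNReal.ofReal |ω x - α| ^ (n + 1) * dualWeight ω x ≤
      ENNReal.ofReal (ε ^ (n + 1) * α) * volume (ball y r) := by
  have hosc : weightedOsc ω ω y r ≤ ENNReal.ofReal ε := by
    refine le_trans ?_ hBMO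
    exact le_iSup₂_of_le y r (le_iSup₂_of_le hr Subset.rfl le_rfl)
  rw [weightedOsc, havg, hW] at hosc
  set I := ∫⁻ x in ball y r, ENNReal.ofReal |ω x - α| ^ (n + 1) * dualWeight ω x
  have hc0 : volume (ball y r) ≠ 0 := (measure_ball_pos _ _ hr).ne'
  have hct : volume (ball y r) ≠ ∞ := measure_ball_lt_top.ne
  have h := pow_le_pow_left' hosc (n + 1)
  rw [← ENNReal.rpow_natCast, ← ENNReal.rpow_mul] at h
  have he : 1 / ((n : ℝ) + 1) * ((n + 1 : ℕ) : ℝ) = 1 := by push_cast; field_simp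
  rw [he, ENNReal.rpow_one, ← ENNReal.ofReal_pow hε.le, mul_comm, ← div_eq_mul_inv,
    ENNReal.div_le_iff (mul_ne_zero (by simpa using hα) hc0)
      (ENNReal.mul_ne_top ENNReal.ofReal_ne_top hct)] at h
  rwa [ENNReal.ofReal_mul (by positivity), mul_assoc]

end WeightFacts

/-- Tonelli on a cylinder for functions of the space variable only. -/
theorem setLIntegral_prod_fst {α β : Type*} [MeasurableSpace α] [MeasurableSpace β]
    {μ : Measure α} {ν : Measure β} [SFinite μ] [SFinite ν] {f : α → ℝ≥0∞}
    {s : Set α} {t : Set β} (hf : AEMeasurable f μ) :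
    ∫⁻ X in s ×ˢ t, f X.1 ∂μ.prod ν = (∫⁻ x in s, f x ∂μ) * ν t := by
  rw [← Measure.prod_restrict]
  have := lintegral_prod_mul (μ := μ.restrict s) (ν := ν.restrict t) hf.restrict
    (aemeasurable_const (b := (1 : ℝ≥0∞)))
  simpa using this

/-! ### Comparison with a quadratic barrier -/

section Barrier

variable {n : ℕ}

theorem Matrix.det_toEuclideanCLM (A : Matrix (Fin n) (Fin n) ℝ) :
    (Matrix.toEuclideanCLM (𝕜 := ℝ) A).det = A.det := by
  rw [ContinuousLinearMap.det, Matrix.coe_toEuclideanCLM_eq_toEuclideanLin]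
  change LinearMap.det (Matrix.toLpLin 2 2 A) = A.det
  rw [Matrix.toLpLin_eq_toLin, LinearMap.det_toLin]

theorem Matrix.posSemidef_neg_of_inner_nonpos {A : Matrix (Fin n) (Fin n) ℝ} (hA : A.IsSymm)
    (h : ∀ z, inner ℝ (Matrix.toEuclideanCLM (𝕜 := ℝ) A z) z ≤ 0) : (-A).PosSemidef := by
  refine Matrix.PosSemidef.of_dotProduct_mulVec_nonneg ?_ fun x => ?_
  · rw [Matrix.IsHermitian, Matrix.conjTranspose_eq_transpose_of_trivial, Matrix.transpose_neg,
      hA.eq]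
  · have := h (WithLp.toLp 2 x)
    rw [real_inner_comm, Matrix.inner_toEuclideanCLM] at this
    simpa [Matrix.neg_mulVec] using this

theorem IsC21On.isSymm_spaceHess {u : SpaceTime n → ℝ} {Ω : Set (SpaceTime n)}
    (hu : IsC21On u Ω) (hΩ : IsOpen Ω) {X : SpaceTime n} (hX : X ∈ Ω) :
    (spaceHess u X).IsSymm := by
  ext i j
  have := hu.inner_spaceHess_comm hΩ hX (EuclideanSpace.single i 1) (EuclideanSpace.single j 1)
  rw [real_inner_comm, Matrix.inner_toEuclideanCLM, real_inner_comm,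
    Matrix.inner_toEuclideanCLM] at this
  simpa using this

/-- Derivatives of `u` minus a quadratic-in-space, linear-in-time barrier. -/
theorem IsC21On.hasDerivAt_sub_barrier {u w : SpaceTime n → ℝ} {Ω : Set (SpaceTime n)}
    (hu : IsC21On u Ω) (hΩ : IsOpen Ω) (hw : EqOn w u Ω) (k l t₀ : ℝ)
    (x₀ : EuclideanSpace ℝ (Fin n)) {X : SpaceTime n} (hX : X ∈ Ω) :
    HasDerivAt (fun t => w (X.1, t) - (k / 2 * ‖X.1 - x₀‖ ^ 2 + l * (t₀ - t)))
        (timeDeriv u X + l) X.2 ∧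
      HasFDerivAt (fun x => w (x, X.2) - (k / 2 * ‖x - x₀‖ ^ 2 + l * (t₀ - X.2)))
        (innerSL ℝ (spaceGrad u X - k • (X.1 - x₀))) X.1 ∧
      HasFDerivAt (fun x => spaceGrad u (x, X.2) - k • (x - x₀))
        (Matrix.toEuclideanCLM (𝕜 := ℝ) (spaceHess u X - k • 1)) X.1 := by
  refine ⟨?_, ?_, ?_⟩
  · have h1 : HasDerivAt (fun t => u (X.1, t)) (timeDeriv u X) X.2 :=
      (hu.time_differentiable X hX).hasDerivAt
    have hev : (fun t => w (X.1, t)) =ᶠ[nhds X.2] fun t => u (X.1, t) := by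
      filter_upwards [(show Continuous fun t => (X.1, t) by fun_prop).continuousAt.eventually
        (hΩ.mem_nhds (show (X.1, X.2) ∈ Ω from hX))] with t ht using hw ht
    have h2 := (h1.congr_of_eventuallyEq hev).sub
      ((((hasDerivAt_id X.2).const_sub t₀).const_mul l).const_add (k / 2 * ‖X.1 - x₀‖ ^ 2))
    refine h2.congr_deriv ?_
    ring
  · have hev : (fun x => w (x, X.2)) =ᶠ[nhds X.1] fun x => u (x, X.2) := by
      filter_upwards [eventually_slice_mem hΩ hX] with x hx using hw hx
    have h2 := ((hu.hasFDerivAt hΩ hX).congr_of_eventuallyEq hev).sub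
      (((((hasFDerivAt_id X.1).sub_const x₀).norm_sq).const_mul (k / 2)).add_const
        (l * (t₀ - X.2)))
    refine h2.congr_fderiv ?_
    ext z
    simp
    ring
  · have h2 := (hu.hasFDerivAt_spaceGrad hΩ hX).sub
      (((hasFDerivAt_id X.1).sub_const x₀).const_smul k)
    refine h2.congr_fderiv ?_
    simp [map_sub, map_smul]
    rfl

/-- Outcome of the ABP estimate for a subsolution compared with a quadratic barrier. -/
theorem exists_contactSet_of_subsolution {ν : ℝ} (hν : 0 < ν)
    {y x₀ : EuclideanSpace ℝ (Fin n)} {r s α β M t₀ m : ℝ} (hr : 0 < r) (hα : 0 < α)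
    (hβ : 0 < β) (hαβ : 1 ≤ α * β) (hM : 0 < M)
    {ω : EuclideanSpace ℝ (Fin n) → ℝ} (hω : ∀ᵐ x, 0 < ω x)
    {a : SpaceTime n → Matrix (Fin n) (Fin n) ℝ} {C : Set (SpaceTime n)}
    (hC : C = ball y r ×ˢ Ioo (s - r ^ 2 * β) s) (ha : IsElliptic ν a C)
    {u : SpaceTime n → ℝ} (hu : IsC21On u C) (huc : ContinuousOn u (closure C))
    (hL : ∀ X ∈ C, parabolicOp ω a u X ≤ 0) (huM : ∀ X ∈ C, u X ≤ M)
    (hx₀ : x₀ ∈ ball y (r / 2)) (ht₀ : t₀ ∈ Ioo (s - r ^ 2 * β / 2) s)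
    (hm : 0 < m) (hum : u (x₀, t₀) = m) :
    ∃ Q : Set (SpaceTime n), Q ⊆ C ∩ {X | 0 < u X} ∧
      ENNReal.ofReal (m / 4) * volume (ball (0 : EuclideanSpace ℝ (Fin n)) (m / (8 * r))) ≤
        ∫⁻ X in Q, ENNReal.ofReal ((ν ^ n)⁻¹ *
          ((3 + 8 * n / ν) * (M / r ^ 2) * (|ω X.1 - α| + α)) ^ (n + 1)) * dualWeight ω X.1 := by
  have hΩ : IsOpen C := hC ▸ isOpen_ball.prod isOpen_Ioo
  set H₀ := r ^ 2 * β with hH₀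
  have hH₀pos : 0 < H₀ := by positivity
  have hclos : closure C = closedBall y r ×ˢ Icc (s - H₀) s := by
    rw [hC, closure_prod_eq, closure_ball y hr.ne', closure_Ioo (by linarith)]
  -- Tietze extension: the ABP estimate wants a globally continuous function.
  obtain ⟨w, hw⟩ := ContinuousMap.exists_restrict_eq (isClosed_closure (s := C))
    ⟨(closure C).domRestrict u, huc.domRestrict⟩
  have hwu : EqOn w u (closure C) := fun X hX => DFunLike.congr_fun hw ⟨X, hX⟩
  have hwuC : EqOn w u C := hwu.mono subset_closure
  have hwM : ∀ X ∈ closure C, w X ≤ M := fun X hX =>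
    closure_minimal (fun Z hZ => (hwuC hZ).trans_le (huM Z hZ))
      (isClosed_le w.continuous continuous_const) hX
  -- Since |x - x₀| ≥ r/2 on the sphere and t₀ is at least H₀/2 above the bottom, k/2 · (r/2)² = M
  -- and l · H₀/2 = M make the barrier reach M there. The error η has the size of l, in terms of α.
  set k := 8 * M / r ^ 2 with hk
  set l := 2 * M / H₀ with hl
  set η := M * α / r ^ 2 with hη
  have hkpos : 0 < k := by positivity
  have hlpos : 0 < l := by positivity
  set v : SpaceTime n → ℝ := fun X => w X - (k / 2 * ‖X.1 - x₀‖ ^ 2 + l * (t₀ - X.2)) with hv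
  have hx₀' : x₀ ∈ ball y r := ball_subset_ball (by linarith) hx₀
  have hat : s - H₀ < t₀ := by linarith [ht₀.1]
  have hX₀ : (x₀, t₀) ∈ C := hC ▸ ⟨hx₀', hat, ht₀.2⟩
  have hder := fun X (hX : X ∈ C) =>
    hu.hasDerivAt_sub_barrier hΩ hwuC k l t₀ x₀ hX
  obtain ⟨Q, hQ, hQsub, hQprop, hQint⟩ := parabolic_abp (v := v)
    (vt := fun X => timeDeriv u X + l) (g := fun X => spaceGrad u X - k • (X.1 - x₀))
    (H := fun X => Matrix.toEuclideanCLM (𝕜 := ℝ) (spaceHess u X - k • 1))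
    (y := y) (x₀ := x₀) (r := r) (a := s - H₀) (b := s) (t₀ := t₀) (m := m) (η := η)
    hr hat ht₀.2 (by fun_prop)
    (fun X hX => (hder X (hC ▸ hX)).1) (fun X hX => (hder X (hC ▸ hX)).2.1)
    (fun X hX => (hder X (hC ▸ hX)).2.2)
    (by rw [← hC]; exact hu.time_continuousOn.add_const l)
    (by
      rw [← hC]
      have : Continuous (Matrix.toEuclideanCLM (n := Fin n) (𝕜 := ℝ)) :=
        LinearMap.continuous_of_finiteDimensional
          ((Matrix.toEuclideanCLM (n := Fin n) (𝕜 := ℝ)).toAlgEquiv.toLinearMap)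
      exact this.comp_continuousOn (hu.continuousOn_spaceHess.sub continuousOn_const))
    hx₀' hm (by simp [hv, hwuC hX₀, hum])
    (by
      intro x hx
      have h1 := hwM (x, s - H₀) (hclos ▸ ⟨hx, le_rfl, by linarith⟩)
      have h2 : M ≤ l * (t₀ - (s - H₀)) := by
        rw [hl, div_mul_eq_mul_div, le_div_iff₀ hH₀pos]
        nlinarith [ht₀.1]
      have h3 : 0 ≤ k / 2 * ‖x - x₀‖ ^ 2 := by positivity
      simp only [hv]
      linarith)
    (by
      intro x hx t ht
      have h1 := hwM (x, t) (hclos ▸ ⟨sphere_subset_closedBall hx, ht.1, by linarith [ht.2, ht₀.2]⟩)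
      have h2 : 0 ≤ l * (t₀ - t) := mul_nonneg hlpos.le (by linarith [ht.2])
      have h3 : r / 2 ≤ ‖x - x₀‖ := by
        rw [← dist_eq_norm]
        have := dist_triangle x x₀ y
        rw [mem_sphere] at hx
        rw [mem_ball] at hx₀
        linarith
      have h4 : M ≤ k / 2 * ‖x - x₀‖ ^ 2 := by
        calc M = k / 2 * (r / 2) ^ 2 := by rw [hk]; field_simp; norm_num
          _ ≤ _ := by gcongr
      simp only [hv]
      linarith)
    (by positivity)
  have hQC : Q ⊆ C := fun X hX => hC ▸
    ⟨(hQsub hX).1, (hQsub hX).2.1, (hQsub hX).2.2.trans_lt ht₀.2⟩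
  refine ⟨Q, fun X hX => ⟨hQC hX, ?_⟩, hQint.trans ?_⟩
  · have h1 := (hQprop X hX).1
    have h2 : 0 ≤ k / 2 * ‖X.1 - x₀‖ ^ 2 := by positivity
    have h3 : 0 ≤ l * (t₀ - X.2) := mul_nonneg hlpos.le (by linarith [(hQsub hX).2.2])
    simp only [hv, hwuC (hQC hX)] at h1
    show 0 < u X
    linarith
  · have hωX : ∀ᵐ X : SpaceTime n, 0 < ω X.1 :=
      Measure.quasiMeasurePreserving_fst.ae hω
    refine setLIntegral_mono_ae' hQ.measurableSet ?_
    filter_upwards [hωX] with X hωp hX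
    obtain ⟨-, hvt, hneg⟩ := hQprop X hX
    have hXC := hQC hX
    have hsymm : (spaceHess u X - k • (1 : Matrix (Fin n) (Fin n) ℝ)).IsSymm :=
      (hu.isSymm_spaceHess hΩ hXC).sub ((Matrix.isSymm_one).smul k)
    have hP := Matrix.posSemidef_neg_of_inner_nonpos hsymm hneg
    set A := spaceHess u X - k • (1 : Matrix (Fin n) (Fin n) ℝ) with hA
    have hdet : |A.det| = (-A).det := by
      rw [← abs_of_nonneg hP.det_nonneg, Matrix.det_neg, abs_mul, abs_pow, abs_neg, abs_one,
        one_pow, one_mul]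
    have hsum : ∑ i, ∑ j, a X i j * (-A) i j =
        k * ∑ i, a X i i - ∑ i, ∑ j, a X i j * spaceDeriv₂ i j u X := by
      -- `spaceHess` stores the two derivatives in the opposite order, so symmetry is used.
      have hH : ∀ i j, spaceHess u X i j = spaceDeriv₂ i j u X := fun i j => by
        rw [← (hu.isSymm_spaceHess hΩ hXC).apply i j]; rfl
      have : ∀ i j, a X i j * (-A) i j =
          a X i j * (k * (1 : Matrix (Fin n) (Fin n) ℝ) i j) - a X i j * spaceDeriv₂ i j u X := by
        intro i j
        rw [hA, ← hH]
        simp only [Matrix.neg_apply, Matrix.sub_apply, Matrix.smul_apply, smul_eq_mul]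
        ring
      simp only [this, Finset.sum_sub_distrib]
      congr 1
      simp [Matrix.one_apply, Finset.mul_sum, mul_comm]
    have htr : ∑ i, a X i i ≤ n / ν := by
      calc ∑ i, a X i i ≤ ∑ _i : Fin n, ν⁻¹ :=
            Finset.sum_le_sum fun i _ => (le_abs_self _).trans (ha.upper X hXC i i)
        _ = n / ν := by simp [div_eq_mul_inv]
    have hLX := hL X hXC
    rw [parabolicOp] at hLX
    -- Here αβ ≥ 1 replaces 1/β by α, so l is comparable with the average of ω.
    have hlα : l ≤ 2 * (M / r ^ 2) * α := by
      rw [hl, hH₀, div_le_iff₀ (by positivity)]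
      have : 2 * (M / r ^ 2) * α * (r ^ 2 * β) = 2 * M * (α * β) := by field_simp
      rw [this]
      nlinarith
    -- The 3 collects l (twice Mα/r²) and η (once); 8n/ν is k times the trace bound n/ν.
    have hF : timeDeriv u X + l + η + ω X.1 * ∑ i, ∑ j, a X i j * (-A) i j ≤
        (3 + 8 * n / ν) * (M / r ^ 2) * (|ω X.1 - α| + α) := by
      rw [hsum]
      have h1 : ω X.1 * (k * ∑ i, a X i i) ≤ 8 * n / ν * (M / r ^ 2) * ω X.1 := by
        calc ω X.1 * (k * ∑ i, a X i i) ≤ ω X.1 * (k * (n / ν)) := by gcongr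
          _ = _ := by rw [hk]; ring
      have h2 : ω X.1 ≤ |ω X.1 - α| + α := by linarith [le_abs_self (ω X.1 - α)]
      have h3 : 8 * n / ν * (M / r ^ 2) * ω X.1 ≤
          8 * n / ν * (M / r ^ 2) * (|ω X.1 - α| + α) := by gcongr
      have h4 : 3 * (M / r ^ 2) * α ≤ 3 * (M / r ^ 2) * (|ω X.1 - α| + α) := by
        gcongr; linarith [abs_nonneg (ω X.1 - α)]
      have h5 : η = M / r ^ 2 * α := by rw [hη]; ring
      nlinarith
    have hmain := hP.mul_det_le hν hωp hvt (ha.lower X hXC) hF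
    rw [Matrix.det_toEuclideanCLM, hdet, dualWeight_eq_ofReal hωp,
      ← ENNReal.ofReal_mul hP.det_nonneg, ← ENNReal.ofReal_mul (by positivity)]
    refine ENNReal.ofReal_le_ofReal (hmain.trans_eq ?_)
    ring

end Barrier

/-! ### From the integral bound to the growth estimate -/

section Growth

variable {n : ℕ}

/-- Convexity splits (|ω - α| + α)^{n+1} at the cost of 2ⁿ. The oscillation is integrated over all
of C, while the constant uses only the small mass of C ∩ P. With height r²β the two parts become
r²εⁿ⁺¹αβ and r²δ(αβ)ⁿ⁺¹, both controlled by K₀ⁿ⁺¹. -/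
theorem lintegral_contactSet_bound {y : EuclideanSpace ℝ (Fin n)} {r H₀ s α β ε δ c K₀ : ℝ}
    {ω : EuclideanSpace ℝ (Fin n) → ℝ} (hω : AEMeasurable ω) (hr : 0 < r) (hα : 0 < α)
    (hβ : 0 < β) (hε : 0 < ε) (hδ : 0 < δ) (hc : 0 ≤ c) (hK₁ : 1 ≤ α * β) (hK : α * β ≤ K₀)
    (hH₀ : H₀ = r ^ 2 * β) {C Q P : Set (SpaceTime n)} (hC : C = ball y r ×ˢ Ioo (s - H₀) s)
    (hQ : Q ⊆ C ∩ P)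
    (hU : ∫⁻ x in ball y r, dualWeight ω x = ENNReal.ofReal (β ^ n) * volume (ball y r))
    (hosc : ∫⁻ x in ball y r, ENNReal.ofReal |ω x - α| ^ (n + 1) * dualWeight ω x ≤
      ENNReal.ofReal (ε ^ (n + 1) * α) * volume (ball y r))
    (hmass : dualMass ω (C ∩ P) ≤ ENNReal.ofReal δ * dualMass ω C) :
    ∫⁻ X in Q, ENNReal.ofReal (c * (|ω X.1 - α| + α) ^ (n + 1)) * dualWeight ω X.1 ≤
      ENNReal.ofReal (c * 2 ^ n * (ε ^ (n + 1) + δ) * K₀ ^ (n + 1) * r ^ 2) *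
        volume (ball y r) := by
  have hdm : AEMeasurable (dualWeight ω) := hω.ennreal_ofReal.pow_const _
  have hom : AEMeasurable fun x => ENNReal.ofReal |ω x - α| ^ (n + 1) * dualWeight ω x :=
    (((hω.sub_const α).norm.ennreal_ofReal).pow_const _).mul hdm
  have hH₀pos : 0 < H₀ := by rw [hH₀]; positivity
  have hvolT : volume (Ioo (s - H₀) s) = ENNReal.ofReal H₀ := by
    rw [Real.volume_Ioo, sub_sub_cancel]
  have hmassC : dualMass ω C = ENNReal.ofReal (β ^ n * H₀) * volume (ball y r) := by
    rw [dualMass, hC, Measure.volume_eq_prod, setLIntegral_prod_fst hdm, hU, hvolT,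
      ENNReal.ofReal_mul (by positivity)]
    ring
  have hI : ∫⁻ X in Q, ENNReal.ofReal |ω X.1 - α| ^ (n + 1) * dualWeight ω X.1 ≤
      ENNReal.ofReal (ε ^ (n + 1) * α * H₀) * volume (ball y r) := by
    calc _ ≤ ∫⁻ X in C, ENNReal.ofReal |ω X.1 - α| ^ (n + 1) * dualWeight ω X.1 :=
          lintegral_mono_set (hQ.trans inter_subset_left)
      _ = (∫⁻ x in ball y r, ENNReal.ofReal |ω x - α| ^ (n + 1) * dualWeight ω x) *
            ENNReal.ofReal H₀ := by
          rw [hC, Measure.volume_eq_prod, setLIntegral_prod_fst hom, hvolT]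
      _ ≤ ENNReal.ofReal (ε ^ (n + 1) * α) * volume (ball y r) * ENNReal.ofReal H₀ := by gcongr
      _ = _ := by
          rw [ENNReal.ofReal_mul (by positivity) (q := H₀)]
          ring
  have hD : ∫⁻ X in Q, dualWeight ω X.1 ≤
      ENNReal.ofReal (δ * (β ^ n * H₀)) * volume (ball y r) := by
    calc _ ≤ dualMass ω (C ∩ P) := lintegral_mono_set hQ
      _ ≤ _ := hmass
      _ = _ := by rw [hmassC, ENNReal.ofReal_mul hδ.le, mul_assoc]
  have hdmX : AEMeasurable (fun X : SpaceTime n => dualWeight ω X.1) :=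
    hdm.comp_quasiMeasurePreserving Measure.quasiMeasurePreserving_fst
  have hpt : ∀ X : SpaceTime n,
      ENNReal.ofReal (c * (|ω X.1 - α| + α) ^ (n + 1)) * dualWeight ω X.1 ≤
        ENNReal.ofReal (c * 2 ^ n) * (ENNReal.ofReal |ω X.1 - α| ^ (n + 1) * dualWeight ω X.1 +
          ENNReal.ofReal (α ^ (n + 1)) * dualWeight ω X.1) := by
    intro X
    rw [← add_mul, ← ENNReal.ofReal_pow (abs_nonneg _),
      ← ENNReal.ofReal_add (by positivity) (by positivity), ← mul_assoc,
      ← ENNReal.ofReal_mul (by positivity)]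
    refine mul_le_mul_left (ENNReal.ofReal_le_ofReal ?_) _
    rw [mul_assoc]
    exact mul_le_mul_of_nonneg_left (add_pow_le (abs_nonneg _) hα.le (n + 1)) hc
  calc _ ≤ ∫⁻ X in Q, ENNReal.ofReal (c * 2 ^ n) *
          (ENNReal.ofReal |ω X.1 - α| ^ (n + 1) * dualWeight ω X.1 +
            ENNReal.ofReal (α ^ (n + 1)) * dualWeight ω X.1) := lintegral_mono hpt
    _ = ENNReal.ofReal (c * 2 ^ n) *
          (∫⁻ X in Q, ENNReal.ofReal |ω X.1 - α| ^ (n + 1) * dualWeight ω X.1) +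
        ENNReal.ofReal (c * 2 ^ n) * (ENNReal.ofReal (α ^ (n + 1)) *
          ∫⁻ X in Q, dualWeight ω X.1) := by
        rw [lintegral_const_mul' _ _ ENNReal.ofReal_ne_top,
          lintegral_add_right' _ (hdmX.restrict.const_mul _),
          lintegral_const_mul' _ _ ENNReal.ofReal_ne_top, mul_add]
    _ ≤ ENNReal.ofReal (c * 2 ^ n) *
          (ENNReal.ofReal (ε ^ (n + 1) * α * H₀) * volume (ball y r)) +
        ENNReal.ofReal (c * 2 ^ n) * (ENNReal.ofReal (α ^ (n + 1)) *
          (ENNReal.ofReal (δ * (β ^ n * H₀)) * volume (ball y r))) := by gcongr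
    _ = ENNReal.ofReal (c * 2 ^ n * (ε ^ (n + 1) * α * H₀) +
          c * 2 ^ n * (α ^ (n + 1) * (δ * (β ^ n * H₀)))) * volume (ball y r) := by
        rw [ENNReal.ofReal_add (by positivity) (by positivity), add_mul,
          ENNReal.ofReal_mul (by positivity) (p := c * 2 ^ n),
          ENNReal.ofReal_mul (by positivity) (p := c * 2 ^ n),
          ENNReal.ofReal_mul (by positivity) (p := α ^ (n + 1))]
        ring
    _ ≤ _ := by
        refine mul_le_mul_left (ENNReal.ofReal_le_ofReal ?_) _
        have hK₀ : 1 ≤ K₀ := hK₁.trans hK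
        have h1 : α * β ≤ K₀ ^ (n + 1) := hK.trans (le_self_pow₀ hK₀ (by omega))
        have h2 : (α * β) ^ (n + 1) ≤ K₀ ^ (n + 1) := pow_le_pow_left₀ (by positivity) hK _
        calc _ = c * 2 ^ n * r ^ 2 * (ε ^ (n + 1) * (α * β) + δ * (α * β) ^ (n + 1)) := by
              rw [hH₀]; ring
          _ ≤ c * 2 ^ n * r ^ 2 * (ε ^ (n + 1) * K₀ ^ (n + 1) + δ * K₀ ^ (n + 1)) := by gcongr
          _ = _ := by ring

/-- Extraction of the growth estimate from the ABP inequality. -/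
theorem le_of_abp_measure_bound {y : EuclideanSpace ℝ (Fin n)} {r m M ε d ν κ K₀ : ℝ}
    (hr : 0 < r) (hm : 0 < m) (hM : 0 < M) (hε : 0 < ε) (hd : 0 < d) (hν : 0 < ν) (hν₁ : ν < 1)
    (hκ : 0 < κ) (hK₀ : 0 < K₀)
    (h : ENNReal.ofReal (m / 4) * volume (ball (0 : EuclideanSpace ℝ (Fin n)) (m / (8 * r))) ≤
      ENNReal.ofReal ((ν ^ n)⁻¹ * (κ * (M / r ^ 2)) ^ (n + 1) * 2 ^ n *
        (ε ^ (n + 1) + d ^ (n + 1)) * K₀ ^ (n + 1) * r ^ 2) * volume (ball y r)) :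
    m ≤ 16 * κ * K₀ / ν * (d + ε) * M := by
  have hV0 : volume (ball (0 : EuclideanSpace ℝ (Fin n)) 1) ≠ 0 :=
    (measure_ball_pos _ _ one_pos).ne'
  have hVt : volume (ball (0 : EuclideanSpace ℝ (Fin n)) 1) ≠ ∞ := measure_ball_lt_top.ne
  rw [Measure.addHaar_ball_of_pos _ _ (by positivity : 0 < m / (8 * r)),
    Measure.addHaar_ball_of_pos _ y hr, ← mul_assoc, ← mul_assoc,
    ENNReal.mul_le_mul_iff_left hV0 hVt, ← ENNReal.ofReal_mul (by positivity),
    ← ENNReal.ofReal_mul (by positivity), ENNReal.ofReal_le_ofReal_iff (by positivity)] at h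
  simp only [finrank_euclideanSpace, Fintype.card_fin] at h
  have h1 : m ^ (n + 1) ≤ 4 * 16 ^ n * (ν ^ n)⁻¹ * (κ * K₀ * M) ^ (n + 1) *
      (ε ^ (n + 1) + d ^ (n + 1)) := by
    have e1 : m ^ (n + 1) = 4 * (8 * r) ^ n * (m / 4 * (m / (8 * r)) ^ n) := by
      rw [div_pow, pow_succ]; field_simp
    rw [e1]
    refine (mul_le_mul_of_nonneg_left h (by positivity)).trans_eq ?_
    have e2 : (16 : ℝ) ^ n = 8 ^ n * 2 ^ n := by rw [← mul_pow]; norm_num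
    rw [e2, mul_pow κ, div_pow, mul_pow (κ * K₀), mul_pow κ, mul_pow 8 r]
    field_simp
    ring
  have h2 : ε ^ (n + 1) + d ^ (n + 1) ≤ (d + ε) ^ (n + 1) := by
    rw [add_comm]; exact pow_add_pow_le hd.le hε.le (by omega)
  -- Rounding ν⁻ⁿ up to ν⁻⁽ⁿ⁺¹⁾, and 4 · 16ⁿ up to 16ⁿ⁺¹, makes the right side an exact (n+1)-st
  -- power.
  have h3 : (ν ^ n)⁻¹ ≤ (ν ^ (n + 1))⁻¹ :=
    inv_anti₀ (by positivity) (pow_le_pow_of_le_one hν.le hν₁.le (by omega))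
  have h4 : m ^ (n + 1) ≤ (16 * κ * K₀ / ν * (d + ε) * M) ^ (n + 1) := by
    calc m ^ (n + 1) ≤ 16 * 16 ^ n * (ν ^ (n + 1))⁻¹ * (κ * K₀ * M) ^ (n + 1) *
          (d + ε) ^ (n + 1) := by
          refine h1.trans ?_
          gcongr
          norm_num
      _ = _ := by
          simp only [mul_pow, div_pow]
          field_simp
          ring
  exact (pow_le_pow_iff_left₀ hm.le (by positivity) (by omega)).1 h4

end Growth

theorem supPos_nonneg {n : ℕ} (u : SpaceTime n → ℝ) (S : Set (SpaceTime n)) :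
    0 ≤ supPos u S :=
  Real.sSup_nonneg (by rintro _ ⟨X, -, rfl⟩; exact le_max_right _ _)

theorem supPos_le {n : ℕ} {u : SpaceTime n → ℝ} {S : Set (SpaceTime n)} {c : ℝ} (hc : 0 ≤ c)
    (h : ∀ X ∈ S, u X ≤ c) : supPos u S ≤ c :=
  Real.sSup_le (by rintro _ ⟨X, hX, rfl⟩; exact max_le (h X hX) hc) hc

/-- A real `sSup` is 0 on unbounded sets, so boundedness is needed; it comes from continuity on the
compact closure. -/
theorem le_supPos {n : ℕ} {u : SpaceTime n → ℝ} {S : Set (SpaceTime n)}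
    (hS : IsCompact (closure S)) (hu : ContinuousOn u (closure S)) {X : SpaceTime n}
    (hX : X ∈ S) : u X ≤ supPos u S := by
  have hb : BddAbove ((fun X => max (u X) 0) '' S) :=
    ((hS.image_of_continuousOn (hu.sup continuousOn_const)).bddAbove).mono
      (image_mono subset_closure)
  exact (le_max_left _ _).trans (le_csSup hb (mem_image_of_mem _ hX))

end

/-! ### The growth lemma -/

theorem proposition3p1 (n : ℕ) (hn : 1 ≤ n) (K₀ : ℝ) (hK₀ : 1 ≤ K₀)
    (ν : ℝ) (hν₀ : 0 < ν) (hν₁ : ν < 1) :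
    ∃ N : ℝ, 0 < N ∧
      ∀ (r : ℝ) (_ : 0 < r) (Y : SpaceTime n)
        (ω : EuclideanSpace ℝ (Fin n) → ℝ) (a : SpaceTime n → Matrix (Fin n) (Fin n) ℝ)
        (_ : IsElliptic ν a (weightedCylinder ω r Y))
        (_ : IsMuckenhoupt (1 + 1 / (n : ℝ)) ω)
        (_ : muckenhouptConst (1 + 1 / (n : ℝ)) ω ≤ ENNReal.ofReal K₀)
        (ε₀ : ℝ) (_ : 0 < ε₀) (_ : ε₀ < 1)
        (_ : weightedBMO ω ω (ball Y.1 r) ≤ ENNReal.ofReal ε₀)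
        (u : SpaceTime n → ℝ)
        (_ : IsC21On u (weightedCylinder ω r Y))
        (_ : ContinuousOn u (closure (weightedCylinder ω r Y)))
        (_ : ∀ X ∈ weightedCylinder ω r Y, parabolicOp ω a u X ≤ 0)
        (δ₀ : ℝ) (_ : 0 < δ₀) (_ : δ₀ < 1)
        (_ : dualMass ω (weightedCylinder ω r Y ∩ {X | 0 < u X}) ≤
          ENNReal.ofReal δ₀ * dualMass ω (weightedCylinder ω r Y)),
        supPos u (weightedCylinder ω (r / 2) Y) ≤
          min (N * (δ₀ ^ (1 / ((n : ℝ) + 1)) + ε₀)) 1 * supPos u (weightedCylinder ω r Y) := by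
  have hn0 : (0 : ℝ) < n := by exact_mod_cast hn
  set κ : ℝ := 3 + 8 * n / ν with hκ
  have hκ0 : 0 < κ := by positivity
  have hK₀pos : 0 < K₀ := by linarith
  refine ⟨16 * κ * K₀ / ν, by positivity, ?_⟩
  intro r hr Y ω a ha hω hK ε hε _ hBMO u hu huc hL δ hδ _ hmass
  obtain ⟨α, β, hα, hβ, hαβ, hαβK, havg, hβeq, hW, hU⟩ := hω.exists_averages hn hK₀ hK Y.1 hr
  obtain ⟨α', β', hα', hβ', -, -, -, hβeq', -, hU'⟩ :=
    hω.exists_averages hn hK₀ hK Y.1 (half_pos hr)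
  set C := weightedCylinder ω r Y with hCdef
  have hC : C = ball Y.1 r ×ˢ Ioo (Y.2 - r ^ 2 * β) Y.2 := by
    rw [hCdef, weightedCylinder, hβeq]
  have hC' : weightedCylinder ω (r / 2) Y =
      ball Y.1 (r / 2) ×ˢ Ioo (Y.2 - (r / 2) ^ 2 * β') Y.2 := by
    rw [weightedCylinder, hβeq']
  -- halving the radius at most doubles the average of the dual weight to the power `1 / n`
  have hββ' : β' ≤ 2 * β := by
    have h1 : ENNReal.ofReal (β' ^ n) * volume (ball Y.1 (r / 2)) ≤
        ENNReal.ofReal (β ^ n) * volume (ball Y.1 r) := by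
      rw [← hU, ← hU']
      exact lintegral_mono_set (ball_subset_ball (by linarith))
    have hV0 : volume (ball (0 : EuclideanSpace ℝ (Fin n)) 1) ≠ 0 :=
      (measure_ball_pos _ _ one_pos).ne'
    have hVt : volume (ball (0 : EuclideanSpace ℝ (Fin n)) 1) ≠ ∞ := measure_ball_lt_top.ne
    rw [Measure.addHaar_ball_of_pos _ _ (half_pos hr), Measure.addHaar_ball_of_pos _ _ hr,
      ← mul_assoc, ← mul_assoc, ENNReal.mul_le_mul_iff_left hV0 hVt,
      ← ENNReal.ofReal_mul (by positivity), ← ENNReal.ofReal_mul (by positivity),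
      ENNReal.ofReal_le_ofReal_iff (by positivity)] at h1
    simp only [finrank_euclideanSpace, Fintype.card_fin] at h1
    rw [← mul_pow, ← mul_pow, pow_le_pow_iff_left₀ (by positivity) (by positivity) (by omega)] at h1
    nlinarith
  -- From β' ≤ 2β the height (r/2)²β' is at most r²β/2, which leaves the lower half of the large
  -- cylinder for the barrier to grow.
  have hsub : weightedCylinder ω (r / 2) Y ⊆
      ball Y.1 (r / 2) ×ˢ Ioo (Y.2 - r ^ 2 * β / 2) Y.2 := by
    rw [hC']
    refine prod_mono_right (Ioo_subset_Ioo_left ?_)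
    nlinarith [sq_nonneg r]
  have hsubC : ball Y.1 (r / 2) ×ˢ Ioo (Y.2 - r ^ 2 * β / 2) Y.2 ⊆ C := by
    rw [hC]
    refine prod_mono (ball_subset_ball (by linarith)) (Ioo_subset_Ioo_left ?_)
    have : 0 < r ^ 2 * β := by positivity
    linarith
  have hcomp : IsCompact (closure C) := by
    rw [hC]
    exact ((isBounded_ball).prod (isBounded_Ioo _ _)).isCompact_closure
  set M := supPos u C with hM
  have hM0 : 0 ≤ M := supPos_nonneg u C
  have huM : ∀ X ∈ C, u X ≤ M := fun X hX => le_supPos hcomp huc hX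
  have hd : 0 < δ ^ (1 / ((n : ℝ) + 1)) := Real.rpow_pos_of_pos hδ _
  set d := δ ^ (1 / ((n : ℝ) + 1)) with hddef
  have hdn : d ^ (n + 1) = δ := by
    rw [hddef, ← Real.rpow_natCast, ← Real.rpow_mul hδ.le]
    push_cast
    rw [one_div_mul_cancel (by positivity), Real.rpow_one]
  have hN0 : 0 ≤ 16 * κ * K₀ / ν * (d + ε) := by positivity
  rw [min_mul_of_nonneg _ _ hM0, one_mul]
  refine le_min (supPos_le (mul_nonneg hN0 hM0) fun X hX => ?_)
    (supPos_le hM0 fun X hX => huM X (hsubC (hsub hX)))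
  rcases le_or_gt (u X) 0 with hu0 | hupos
  · exact hu0.trans (mul_nonneg hN0 hM0)
  have hMpos : 0 < M := hupos.trans_le (huM X (hsubC (hsub hX)))
  -- The barrier is centred at the point X itself, with m = u X.
  obtain ⟨Q, hQ, hQint⟩ := exists_contactSet_of_subsolution hν₀ hr hα hβ hαβ hMpos hω.pos_ae hC
    ha hu huc hL huM (hsub hX).1 (hsub hX).2 hupos rfl
  refine le_of_abp_measure_bound (y := Y.1) hr hupos hMpos hε hd hν₀ hν₁ hκ0 hK₀pos
    (hQint.trans ?_)
  have hbd := lintegral_contactSet_bound (c := (ν ^ n)⁻¹ * (κ * (M / r ^ 2)) ^ (n + 1))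
    hω.aemeasurable hr hα hβ hε hδ (by positivity) hαβ hαβK rfl hC hQ hU
    (lintegral_rpow_oscillation_le hr hα hε hW havg hBMO) hmass
  rw [hdn]
  refine le_trans (le_of_eq ?_) hbd
  refine lintegral_congr fun X => ?_
  rw [mul_pow _ (_ + _), ← mul_assoc]
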